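/- **Setting.** An episodic POMDP has horizon $H\ge 1$, a state space $\mathcal S$ with fixed initial state $s_0$, a finite action set $\mathcal A$ with $|\mathcal A|=A\ge 1$, an observation space $\mathcal O$, and, for $0\le h<H$, transition laws $\mathbb T_h(\cdot\mid s,a)$ on $\mathcal S$, emission laws $\mathbb O_h(\cdot\mid s)$ on $\mathcal O$ and reward laws $\mathbb Y_h(\cdot\mid s,a)$ on $[0,1]$ with means $r_h(s,a)$. At step $h$ the agent sees $o_h\sim\mathbb O_h(\cdot\mid s_h)$, plays $a_h$, receives a reward drawn from $\mathbb Y_h(\cdot\mid s_h,a_h)$, and $s_{h+1}\sim\mathbb T_h(\cdot\mid s_h,a_h)$; the states are hidden. Let $\psi:\mathcal O\to\mathbb R^d$ be a known feature with $\|\psi(o)\|\le 1$ for all $o$, and $\phi:\mathcal S\to\mathbb R^{d_s}$, $d_s\ge 1$. Assume: 1. (Left-invertible conditional embedding) for every $h<H$ there is a left-invertible matrix $G_h\in\mathbb R^{d\times d_s}$ with $\mathbb E_{o\sim\mathbb O_h(s)}[\psi(o)]=G_h\phi(s)$ for all $s$; 2. (Deterministic latent transitions) $\mathbb T_h(\cdot\mid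 s,a)$ is the Dirac measure at $p_h(s,a)$; 3. (Linear $Q^\star$) with $Q^\star_H=0$, $V^\star_h(s)=\max_a Q^\star_h(s,a)$ and $Q^\star_h(s,a)=r_h(s,a)+V^\star_{h+1}(p_h(s,a))$, one has $Q^\star_h(s,a)=\langle w^\star_{a;h},\phi(s)\rangle$ for all $s$, with $\|w^\star_{a;h}\|\le W$, for all $h<H$ and $a\in\mathcal A$; 4. (Gap) whenever $\mathrm{gap}_h(s,a)=V^\star_h(s)-Q^\star_h(s,a)$ is positive, it is at least $\Delta$, where $\Delta>0$. Let $\Theta=W/\min_{h<H}\eta(G_h)$, where $\eta$ denotes the smallest singular value, and assume $\Theta\ge 1$ and $\Delta\le\Theta$. (The first holds after enlarging $W$ if necessary; the second is automatic as soon as some gap is positive.) Let $0<\delta\le 1/2$. **Algorithm EQDP** (parameters $\lambda>0$, $M\ge 1$, $\varepsilon>0$). It keeps lists $\mathcal D_h$ of vectors of $\mathbb R^d$ and $\mathcal D_{a;h}$ of pairs $(x,y)\in\mathbb R^d\times\mathbb R$, all initially empty. Put $\Sigma_h=\lambda I+\sum_{x\in\mathcal D_h}xx^\top$, $\|x\|_{\Sigma_h^{-1}}=(x^\top\Sigma_h^{-1}x)^{1/2}$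 and $\hat\theta_{a;h}=\Sigma_h^{-1}\sum_{(x,y)\in\mathcal D_{a;h}}yx$, always for the current lists. For an action sequence $a_{0:h-1}$, $\hat x_h(a_{0:h-1})$ is the mean of $\psi(o_h)$ over $M$ fresh episodes in which $a_{0:h-1}$ is executed, and $\hat r_h(a_{0:h-1},a)$ is the mean reward at step $h$ over $M$ fresh episodes in which $a_{0:h-1},a$ is executed. Ties in every $\arg\max$ are broken arbitrarily. *Explore*$(a_{0:h-1},x)$: for each $a\in\mathcal A$ in turn, compute $y_a=\hat r_h(a_{0:h-1},a)+\text{Compute-}V^\star(h+1;a_{0:h-1},a)$ and append $(x,y_a)$ to $\mathcal D_{a;h}$; after this loop append $x$ to $\mathcal D_h$. *Compute-$V^\star$*$(h;a_{0:h-1})$: if $h=H$, return $0$. If $h=H-1$, return $\max_a\hat r_h(a_{0:h-1},a)$. Otherwise form $x=\hat x_h(a_{0:h-1})$. If $\|x\|_{\Sigma_h^{-1}}\le\varepsilon$, let $a_h\in\arg\max_a\langle\hat\theta_{a;h},x\rangle$ and return $\hat r_h(a_{0:h-1},a_h)+\text{Compute-}V^\star(h+1;a_{0:h-1},a_h)$;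 else run Explore$(a_{0:h-1},x)$ and return $\max_a y_a$. *Main loop*: repeat the following. For $h=0,\dots,H-1$ form $\hat x_h(a_{0:h-1})$ and choose $a_h\in\arg\max_a\langle\hat\theta_{a;h},\hat x_h(a_{0:h-1})\rangle$. If $\|\hat x_h(a_{0:h-1})\|_{\Sigma_h^{-1}}\le\varepsilon$ for all $h$, return $a_{0:H-1}$ and stop; else run Explore$(a_{0:h-1},\hat x_h(a_{0:h-1}))$ for the smallest $h$ that violates this. **Theorem (Sample Complexity).** There are universal constants $C>0$ and $m\in\mathbb N$ such that, for suitable $\lambda,M,\varepsilon$ that depend only on $H,d,A,\Theta,\Delta,\delta$, the following holds for every POMDP as above. With probability at least $1-\delta$, EQDP terminates and returns an optimal action sequence $a^\star_{0:H-1}$, that is, one whose expected total reward is maximal among all history-dependent policies, after using at most $$C\,L^m\,H^5\,\Theta^5\,d^2A^2\,\Delta^{-5}\ln(1/\delta),\qquad L=\ln\bigl(2+H+d+A+\Theta+1/\Delta+\ln(1/\delta)\bigr),$$ samples, where every executed episode is counted as $H$ samples. In other words, the sample complexity is $\tilde O\bigl(H^5\Theta^5d^2A^2\Delta^{-5}\ln(1/\delta)\bigr)$.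 -/

import Mathlib

open MeasureTheory ProbabilityTheory
open scoped ENNReal

namespace EQDP

/-! ## Partially observable Markov decision processes -/

/-- An episodic POMDP with states `S`, actions `A` and observations `O`.  All families are indexed
by `h : ℕ`; with a horizon `H`, only the members with `h < H` play a role. -/
structure POMDP (S A O : Type*) [MeasurableSpace S] [MeasurableSpace O] where
  /-- the latent transition `T_h(· | s, a)` -/
  trans : ℕ → A → Kernel S S
  /-- the emission distribution `O_h(· | s)` -/
  emit : ℕ → Kernel S O
  /-- the reward distribution `Y_h(· | s, a)` -/
  rew : ℕ → A → Kernel S ℝ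
  /-- the initial state -/
  init : S
  trans_markov : ∀ h a, IsMarkovKernel (trans h a)
  emit_markov : ∀ h, IsMarkovKernel (emit h)
  rew_markov : ∀ h a, IsMarkovKernel (rew h a)
  /-- rewards lie in `[0, 1]` -/
  rew_mem : ∀ h a s, ∀ᵐ y ∂(rew h a s), y ∈ Set.Icc (0 : ℝ) 1

namespace POMDP

variable {S A O : Type*} [MeasurableSpace S] [MeasurableSpace O]

/-- The mean reward `r_h(s, a)`. -/
noncomputable def meanReward (P : POMDP S A O) (h : ℕ) (s : S) (a : A) : ℝ :=
  ∫ y, y ∂(P.rew h a s)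

/-- The law of the latent state after executing a list of actions from time `h` on, when the law of
the state at time `h` is `μ`. -/
noncomputable def stateLawFrom (P : POMDP S A O) : ℕ → Measure S → List A → Measure S
  | _, μ, [] => μ
  | h, μ, a :: l => stateLawFrom P (h + 1) (μ.bind (P.trans h a)) l

/-- The law of the latent state at time `h` after executing the actions `l = a_{0:h-1}` in a new
episode (here `h = l.length`). -/
noncomputable def stateLaw (P : POMDP S A O) (l : List A) : Measure S :=
  P.stateLawFrom 0 (Measure.dirac P.init) l

/-- The law of the observation `o_h` after executing `l = a_{0:h-1}` in a new episode. -/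
noncomputable def obsLaw (P : POMDP S A O) (l : List A) : Measure O :=
  (P.stateLaw l).bind (P.emit l.length)

/-- The law of the reward at time `h` after executing `l = a_{0:h-1}` and then `a` in a new
episode. -/
noncomputable def rewLaw (P : POMDP S A O) (l : List A) (a : A) : Measure ℝ :=
  (P.stateLaw l).bind (P.rew l.length a)

/-! ### Policies and optimal action sequences -/

/-- A history-dependent, possibly randomized policy.  It sees the past triples
`(o_k, a_k, r_k)`, `k < h`, and the current observation `o_h`; the time `h` is the length of the
history. -/
abbrev Policy (A O : Type*) := List (O × A × ℝ) → O → PMF A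

/-- The expected sum of the next `n` rewards under the policy `π`, starting at time `h` in the
latent state `s` with the given observable history.  (Rewards are nonnegative, so the expectations
are written as integrals with values in `[0, ∞]`.) -/
noncomputable def policyValueFrom [Fintype A] (P : POMDP S A O) (π : Policy A O) :
    ℕ → ℕ → S → List (O × A × ℝ) → ℝ≥0∞
  | 0, _, _, _ => 0
  | n + 1, h, s, hist =>
      ∫⁻ o, ∑ a : A, π hist o a *
        ∫⁻ y, (ENNReal.ofReal y +
          ∫⁻ s', policyValueFrom P π n (h + 1) s' (hist ++ [(o, a, y)]) ∂(P.trans h a s))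
        ∂(P.rew h a s) ∂(P.emit h s)

/-- The expected total reward `E_π[∑_{h < H} r_h]` of a policy in an episode of length `H`. -/
noncomputable def policyValue [Fintype A] (P : POMDP S A O) (H : ℕ) (π : Policy A O) : ℝ≥0∞ :=
  P.policyValueFrom π H 0 P.init []

/-- The policy that plays the fixed action sequence `l` (and an arbitrary action after its end). -/
noncomputable def openLoop [Nonempty A] (l : List A) : Policy A O :=
  fun hist _ => PMF.pure ((l[hist.length]?).getD (Classical.arbitrary A))

/-- `l = a_{0:H-1}` is an optimal action sequence: as a policy it is a maximizer of the expected
total reward among all history-dependent policies. -/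
def IsOptimalSeq [Fintype A] [Nonempty A] (P : POMDP S A O) (H : ℕ) (l : List A) : Prop :=
  l.length = H ∧ ∀ π : Policy A O, P.policyValue H π ≤ P.policyValue H (openLoop l)

/-! ### Optimal value functions under deterministic transitions -/

/-- The optimal value with `n` steps to go at time `h`, for the deterministic transition map `p`. -/
noncomputable def valueToGo [Fintype A] [Nonempty A] (P : POMDP S A O) (p : ℕ → S → A → S) :
    ℕ → ℕ → S → ℝ
  | 0, _, _ => 0
  | n + 1, h, s =>
      Finset.univ.sup' Finset.univ_nonempty
        (fun a : A => P.meanReward h s a + valueToGo P p n (h + 1) (p h s a))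

/-- `Q*_h(s, a) = r_h(s, a) + max_{a'} Q*_{h+1}(p_h(s, a), a')` for `h < H`, with `Q*_H = 0`. -/
noncomputable def Qstar [Fintype A] [Nonempty A] (P : POMDP S A O) (p : ℕ → S → A → S)
    (H h : ℕ) (s : S) (a : A) : ℝ :=
  if h < H then P.meanReward h s a + P.valueToGo p (H - (h + 1)) (h + 1) (p h s a) else 0

/-- `V*_h(s) = max_a Q*_h(s, a)`. -/
noncomputable def Vstar [Fintype A] [Nonempty A] (P : POMDP S A O) (p : ℕ → S → A → S)
    (H h : ℕ) (s : S) : ℝ :=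
  Finset.univ.sup' Finset.univ_nonempty (fun a : A => P.Qstar p H h s a)

/-- `gap_h(s, a) = V*_h(s) - Q*_h(s, a)`. -/
noncomputable def gap [Fintype A] [Nonempty A] (P : POMDP S A O) (p : ℕ → S → A → S)
    (H h : ℕ) (s : S) (a : A) : ℝ :=
  P.Vstar p H h s - P.Qstar p H h s a

end POMDP

/-- The smallest singular value of a `d × k` matrix (the singular values are listed in decreasing
order, starting from index `0`). -/
noncomputable def smallestSingularValue {d k : ℕ} (G : Matrix (Fin d) (Fin k) ℝ) : ℝ :=
  (Matrix.toEuclideanLin G).singularValues (min d k - 1)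

/-! ## Programs that interact with an unknown POMDP -/

/-- A program that interacts with an environment by running episodes and finally returns an element
of `α`.  Everything it does depends on the environment only through the samples it has received. -/
inductive Prog (A O α : Type*)
  /-- stop and return a value -/
  | ret (x : α) : Prog A O α
  /-- execute `a_{0:h-1}` in a new episode, read the observation `o_h`, and continue -/
  | observe (l : List A) (k : O → Prog A O α) : Prog A O α
  /-- execute `a_{0:h-1}` and then `a` in a new episode, read the reward at time `h`, continue -/
  | reward (l : List A) (a : A) (k : ℝ → Prog A O α) : Prog A O α

namespace Prog

variable {S A O : Type*} [MeasurableSpace S] [MeasurableSpace O]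

/-- Sequential composition. -/
def bind {α β : Type*} : Prog A O α → (α → Prog A O β) → Prog A O β
  | ret x, f => f x
  | observe l k, f => observe l (fun o => (k o).bind f)
  | reward l a k, f => reward l a (fun y => (k y).bind f)

/-- Run a program `n` times in a row and list the results. -/
def replicate {α : Type*} : ℕ → Prog A O α → Prog A O (List α)
  | 0, _ => ret []
  | n + 1, q => q.bind fun x => (replicate n q).bind fun xs => ret (x :: xs)

/-- The expectation of `f (result) (number of episodes)` for a program that is run on the POMDP `P`
when `n` episodes have been executed before. -/
noncomputable def expect {α : Type*} (P : POMDP S A O) (f : α → ℕ → ℝ≥0∞) :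
    Prog A O α → ℕ → ℝ≥0∞
  | ret x, n => f x n
  | observe l k, n => ∫⁻ o, expect P f (k o) (n + 1) ∂(P.obsLaw l)
  | reward l a k, n => ∫⁻ y, expect P f (k y) (n + 1) ∂(P.rewLaw l a)

open Classical in
/-- The probability that the program, run on `P`, stops with a result `x` after a number `n` of
episodes such that `E x n` holds. -/
noncomputable def prob {α : Type*} (P : POMDP S A O) (q : Prog A O α) (E : α → ℕ → Prop) : ℝ≥0∞ :=
  q.expect P (fun x n => if E x n then 1 else 0) 0

end Prog

/-! ## The algorithm -/

/-- The inputs of the algorithm: horizon, observation feature, the parameters `M`, `ε`, `λ`, and the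
rule that selects a maximizer in `argmax_a`. -/
structure Params (A O : Type*) (d : ℕ) where
  H : ℕ
  ψ : O → EuclideanSpace ℝ (Fin d)
  M : ℕ
  ε : ℝ
  lam : ℝ
  argmax : (A → ℝ) → A

/-- The data sets: `feats h` is `D_h` and `pairs a h` is `D_{a;h}`. -/
structure Data (A : Type*) (d : ℕ) where
  feats : ℕ → List (EuclideanSpace ℝ (Fin d))
  pairs : A → ℕ → List (EuclideanSpace ℝ (Fin d) × ℝ)

namespace Data

variable {A : Type*} {d : ℕ}

/-- All data sets are empty. -/
def empty : Data A d := ⟨fun _ => [], fun _ _ => []⟩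

/-- Add `x` to `D_h`. -/
def addFeat (D : Data A d) (h : ℕ) (x : EuclideanSpace ℝ (Fin d)) : Data A d :=
  { D with feats := Function.update D.feats h (D.feats h ++ [x]) }

open Classical in
/-- Add `(x, y)` to `D_{a;h}`. -/
noncomputable def addPair (D : Data A d) (a : A) (h : ℕ) (x : EuclideanSpace ℝ (Fin d)) (y : ℝ) :
    Data A d :=
  { D with pairs := fun b k =>
      if b = a ∧ k = h then D.pairs b k ++ [(x, y)] else D.pairs b k }

/-- `Σ_h = ∑_{x ∈ D_h} x xᵀ + λ I`. -/
noncomputable def Sig (D : Data A d) (lam : ℝ) (h : ℕ) : Matrix (Fin d) (Fin d) ℝ :=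
  ((D.feats h).map fun x => Matrix.vecMulVec x.ofLp x.ofLp).sum + lam • 1

/-- `‖x‖_{Σ_h⁻¹}`, the square root of `xᵀ Σ_h⁻¹ x`. -/
noncomputable def invNorm (D : Data A d) (lam : ℝ) (h : ℕ) (x : EuclideanSpace ℝ (Fin d)) : ℝ :=
  Real.sqrt (x.ofLp ⬝ᵥ ((D.Sig lam h)⁻¹.mulVec x.ofLp))

/-- The ridge regression estimator: `Σ_h⁻¹ ∑ x y` over the pairs `(x, y)` in `D_{a;h}`. -/
noncomputable def thetaHat (D : Data A d) (lam : ℝ) (a : A) (h : ℕ) : Fin d → ℝ :=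
  (D.Sig lam h)⁻¹.mulVec ((D.pairs a h).map fun z => z.2 • z.1.ofLp).sum

end Data

section Algorithm

variable {A O : Type*} {d : ℕ}

/-- Collect `M` observations after `l = a_{0:h-1}` and return the mean of their features. -/
noncomputable def estFeature (c : Params A O d) (l : List A) :
    Prog A O (EuclideanSpace ℝ (Fin d)) :=
  (Prog.replicate c.M (Prog.observe l Prog.ret)).bind fun os =>
    Prog.ret ((c.M : ℝ)⁻¹ • (os.map c.ψ).sum)

/-- Collect `M` rewards of the action `a` after `l = a_{0:h-1}` and return their mean. -/
noncomputable def estReward (c : Params A O d) (l : List A) (a : A) : Prog A O ℝ :=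
  (Prog.replicate c.M (Prog.reward l a Prog.ret)).bind fun ys =>
    Prog.ret ((c.M : ℝ)⁻¹ * ys.sum)

/-- `argmax_a ⟨θ̂_{a;h}, x⟩`. -/
noncomputable def greedy (c : Params A O d) (D : Data A d) (h : ℕ)
    (x : EuclideanSpace ℝ (Fin d)) : A :=
  c.argmax fun a => D.thetaHat c.lam a h ⬝ᵥ x.ofLp

open Classical in
/-- Estimate the rewards, after `l`, of all actions in a list. -/
noncomputable def rewardLoop (c : Params A O d) (l : List A) :
    List A → (A → ℝ) → Prog A O (A → ℝ)
  | [], y => Prog.ret y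
  | a :: as, y => (estReward c l a).bind fun r => rewardLoop c l as (Function.update y a r)

open Classical in
/-- The loop over the actions in a bad event at `l = a_{0:h-1}` with estimated feature `x`.  For each
action `a` in turn, the target `y_a` is the estimated reward plus the result of the recursive call
`rec (a_{0:h-1}, a)`, and `(x, y_a)` is added to `D_{a;h}`.  The targets are collected in `y`. -/
noncomputable def exploreLoop (c : Params A O d)
    (rec : List A → Data A d → Prog A O (ℝ × Data A d)) (l : List A)
    (x : EuclideanSpace ℝ (Fin d)) :
    List A → (A → ℝ) → Data A d → Prog A O ((A → ℝ) × Data A d)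
  | [], y, D => Prog.ret (y, D)
  | a :: as, y, D =>
      (estReward c l a).bind fun r =>
      (rec (l ++ [a]) D).bind fun v =>
      exploreLoop c rec l x as (Function.update y a (r + v.1))
        (v.2.addPair a l.length x (r + v.1))

/-- A bad event: the loop over all actions, after which `x` is added to `D_h`. -/
noncomputable def explore [Fintype A] (c : Params A O d)
    (rec : List A → Data A d → Prog A O (ℝ × Data A d)) (l : List A)
    (x : EuclideanSpace ℝ (Fin d)) (D : Data A d) : Prog A O ((A → ℝ) × Data A d) :=
  (exploreLoop c rec l x Finset.univ.toList (fun _ => 0) D).bind fun z =>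
    Prog.ret (z.1, z.2.addFeat l.length x)

open Classical in
/-- The subroutine `Compute-V*(h; a_{0:h-1})`.  The first argument is the number `H - h` of remaining
steps, and `l = a_{0:h-1}`.  `Compute-V*(H; ·)` is `0`. -/
noncomputable def computeV [Fintype A] [Nonempty A] (c : Params A O d) :
    ℕ → List A → Data A d → Prog A O (ℝ × Data A d)
  | 0, _, D => Prog.ret (0, D)
  | 1, l, D =>
      (rewardLoop c l Finset.univ.toList (fun _ => 0)).bind fun y =>
        Prog.ret (Finset.univ.sup' Finset.univ_nonempty y, D)
  | n + 2, l, D =>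
      (estFeature c l).bind fun x =>
      if D.invNorm c.lam l.length x ≤ c.ε then
        (estReward c l (greedy c D l.length x)).bind fun r =>
        (computeV c (n + 1) (l ++ [greedy c D l.length x]) D).bind fun v =>
        Prog.ret (r + v.1, v.2)
      else
        (explore c (computeV c (n + 1)) l x D).bind fun z =>
        Prog.ret (Finset.univ.sup' Finset.univ_nonempty z.1, z.2)

/-- The `for` loop of the main algorithm: starting from `l = a_{0:h-1}`, choose `n` further greedy
actions.  It returns the whole action sequence and the list of the pairs
`(a_{0:k-1}, x̂_k(a_{0:k-1}))` in the order of increasing `k`. -/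
noncomputable def rollout (c : Params A O d) (D : Data A d) :
    ℕ → List A → Prog A O (List A × List (List A × EuclideanSpace ℝ (Fin d)))
  | 0, l => Prog.ret (l, [])
  | n + 1, l =>
      (estFeature c l).bind fun x =>
      (rollout c D n (l ++ [greedy c D l.length x])).bind fun z =>
      Prog.ret (z.1, (l, x) :: z.2)

open Classical in
/-- At most `n` iterations of the `while` loop of the main algorithm, starting with the data sets
`D`.  The result is `none` if the loop has not been left by then. -/
noncomputable def mainLoop [Fintype A] [Nonempty A] (c : Params A O d) :
    ℕ → Data A d → Prog A O (Option (List A))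
  | 0, _ => Prog.ret none
  | n + 1, D =>
      (rollout c D c.H []).bind fun z =>
      match z.2.find? (fun q => decide (c.ε < D.invNorm c.lam q.1.length q.2)) with
      | none => Prog.ret (some z.1)
      | some q =>
          (explore c (computeV c (c.H - (q.1.length + 1))) q.1 q.2 D).bind fun w =>
          mainLoop c n w.2

/-- The probability that the algorithm, run on `P`, terminates and returns an action sequence `l`
after having used a number `N` of samples such that `E l N` holds.  An episode counts as `H`
samples, whatever part of it is used.  The supremum over the number of iterations that are carried
out of the `while` loop is the limit of an increasing sequence of probabilities. -/
noncomputable def successProb [Fintype A] [Nonempty A] {S : Type*} [MeasurableSpace S]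
    [MeasurableSpace O] (c : Params A O d) (P : POMDP S A O) (E : List A → ℕ → Prop) : ℝ≥0∞ :=
  ⨆ n : ℕ, (mainLoop c n Data.empty).prob P
    (fun out k => ∃ l, out = some l ∧ E l (c.H * k))

end Algorithm

end EQDP

/-!
Since the latent transitions are deterministic, an action sequence determines the state it leads to,
no policy collects more than `V⋆_0(s₀)`, and some action sequence collects exactly that much. The
left inverse of `G_h` turns the linearity of `Q⋆` in `φ(s)` into linearity in the mean observation
feature `E[ψ(o)]`, with a parameter of norm at most `Θ`. The mean feature and the mean rewards are
estimated by averages over `M` episodes, which by Hoeffding's inequality are accurate except with a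
small probability per estimate.

With the threshold `ε = 1`, a feature `x` with `‖x‖_{Σ⁻¹} ≤ 1` is one on which ridge regression
predicts `Q⋆` up to an error `√λ Θ + O(error √n)`, `n` the number of stored features. For a suitable
`λ` and `M` this is below `Δ / 2`, so that the greedy action is optimal. A feature with
`‖x‖_{Σ⁻¹} > 1` at least doubles `det Σ_h` when it is stored, while `det Σ_h ≤ (tr Σ_h)^d` and
`tr Σ_h ≤ n + λ d`; hence `n = O(d log (d / λ))` at each level. As every call of Compute-`V⋆`
either follows a greedy action, at a cost of two estimates, or pays for its exploration with such a
doubling, the total number of estimates is `O(H² A² n)`, and a union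
bound over these estimates fixes `M`.
-/

namespace EQDP

/-! ## Ridge regression -/

section Ridge

open Matrix

variable {ι : Type*}

theorem dotProduct_ofLp_self [Fintype ι] (x : EuclideanSpace ℝ ι) : x.ofLp ⬝ᵥ x.ofLp = ‖x‖ ^ 2 := by
  rw [EuclideanSpace.real_norm_sq_eq]
  simp only [dotProduct, sq]

theorem real_inner_eq_dotProduct [Fintype ι] (x y : EuclideanSpace ℝ ι) :
    inner ℝ x y = x.ofLp ⬝ᵥ y.ofLp := by
  rw [EuclideanSpace.inner_eq_star_dotProduct, star_trivial, dotProduct_comm]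

theorem mul_abs_dotProduct_le_sqrt_mul_norm [Fintype ι] {lam : ℝ} (hlam : 0 ≤ lam)
    (θ : EuclideanSpace ℝ ι) {u : EuclideanSpace ℝ ι} (hu : lam * ‖u‖ ^ 2 ≤ 1) :
    lam * |θ.ofLp ⬝ᵥ u.ofLp| ≤ √lam * ‖θ‖ := by
  have hu' : √lam * ‖u‖ ≤ 1 := by
    refine (sq_le_one_iff₀ (by positivity)).1 ?_
    rwa [mul_pow, Real.sq_sqrt hlam]
  have hθu : |θ.ofLp ⬝ᵥ u.ofLp| ≤ ‖θ‖ * ‖u‖ :=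
    real_inner_eq_dotProduct θ u ▸ abs_real_inner_le_norm θ u
  calc lam * |θ.ofLp ⬝ᵥ u.ofLp|
      ≤ lam * (‖θ‖ * ‖u‖) := by gcongr
    _ = √lam * ‖θ‖ * (√lam * ‖u‖) := by
        nth_rewrite 1 [← Real.mul_self_sqrt hlam]
        ring
    _ ≤ √lam * ‖θ‖ := mul_le_of_le_one_right (by positivity) hu'

theorem abs_sum_mul_le_mul_sqrt_length {β : ℝ} (L : List ι) {f g : ι → ℝ} (hβ : 0 ≤ β)
    (hf : ∀ i ∈ L, |f i| ≤ β) (hg : (L.map fun i => g i ^ 2).sum ≤ 1) :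
    |(L.map fun i => f i * g i).sum| ≤ β * √L.length := by
  rw [← Fin.sum_univ_fun_getElem] at hg ⊢
  have hf' : ∑ i : Fin L.length, f L[i] ^ 2 ≤ L.length * β ^ 2 := by
    refine (Finset.sum_le_card_nsmul _ _ (β ^ 2) fun i _ => ?_).trans_eq (by simp)
    exact sq_le_sq.2 ((hf _ (L.getElem_mem i.2)).trans (le_abs_self β))
  refine abs_le_of_sq_le_sq ?_ (by positivity)
  calc (∑ i : Fin L.length, f L[i] * g L[i]) ^ 2
      ≤ (∑ i : Fin L.length, f L[i] ^ 2) * ∑ i : Fin L.length, g L[i] ^ 2 :=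
        Finset.sum_mul_sq_le_sq_mul_sq _ _ _
    _ ≤ L.length * β ^ 2 * 1 :=
        mul_le_mul hf' hg (Finset.sum_nonneg fun i _ => sq_nonneg _) (by positivity)
    _ = (β * √L.length) ^ 2 := by
        rw [mul_pow, Real.sq_sqrt (Nat.cast_nonneg _)]
        ring

variable [DecidableEq ι]

/-- The regularized Gram matrix `∑ x xᵀ + λ I` of a list of vectors, which is `Σ_h` for the list
`D_h`. -/
noncomputable def ridge (lam : ℝ) (L : List (EuclideanSpace ℝ ι)) : Matrix ι ι ℝ :=
  (L.map fun x => vecMulVec x.ofLp x.ofLp).sum + lam • 1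

theorem Data.Sig_eq_ridge {A : Type*} {d : ℕ} (D : Data A d) (lam : ℝ) (h : ℕ) :
    D.Sig lam h = ridge lam (D.feats h) := rfl

theorem ridge_nil (lam : ℝ) : ridge (ι := ι) lam [] = lam • 1 := by
  simp only [ridge, List.map_nil, List.sum_nil, zero_add]

theorem ridge_cons (lam : ℝ) (x : EuclideanSpace ℝ ι) (L : List (EuclideanSpace ℝ ι)) :
    ridge lam (x :: L) = vecMulVec x.ofLp x.ofLp + ridge lam L := by
  simp only [ridge, List.map_cons, List.sum_cons, add_assoc]

theorem ridge_append_singleton (lam : ℝ) (L : List (EuclideanSpace ℝ ι))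
    (x : EuclideanSpace ℝ ι) :
    ridge lam (L ++ [x]) = ridge lam L + vecMulVec x.ofLp x.ofLp := by
  simp only [ridge, List.map_append, List.sum_append, List.map_cons, List.map_nil, List.sum_cons,
    List.sum_nil, add_zero]
  abel

theorem posDef_ridge [Finite ι] {lam : ℝ} (hlam : 0 < lam) (L : List (EuclideanSpace ℝ ι)) :
    (ridge lam L).PosDef := by
  induction L with
  | nil => exact ridge_nil (ι := ι) lam ▸ PosDef.one.smul hlam
  | cons x L ih => exact ridge_cons lam x L ▸ ih.posSemidef_add (posSemidef_vecMulVec_self_star _)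

variable [Fintype ι]

theorem isUnit_det_ridge {lam : ℝ} (hlam : 0 < lam) (L : List (EuclideanSpace ℝ ι)) :
    IsUnit (ridge lam L).det :=
  (posDef_ridge hlam L).det_pos.ne'.isUnit

theorem det_ridge_append_singleton {lam : ℝ} (hlam : 0 < lam) (L : List (EuclideanSpace ℝ ι))
    (x : EuclideanSpace ℝ ι) :
    (ridge lam (L ++ [x])).det
      = (ridge lam L).det * (1 + x.ofLp ⬝ᵥ ((ridge lam L)⁻¹ *ᵥ x.ofLp)) := by
  rw [ridge_append_singleton, vecMulVec_eq Unit,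
    det_add_replicateCol_mul_replicateRow (isUnit_det_ridge hlam L)]
  congr 1
  rw [det_unique, Matrix.add_apply, one_apply_eq, Matrix.mul_assoc, ← replicateCol_mulVec]
  rfl

theorem trace_ridge_le (lam : ℝ) {L : List (EuclideanSpace ℝ ι)} (hL : ∀ x ∈ L, ‖x‖ ≤ 1) :
    (ridge lam L).trace ≤ L.length + lam * Fintype.card ι := by
  induction L with
  | nil => simp [ridge_nil]
  | cons x L ih =>
    have hx : ‖x‖ ^ 2 ≤ 1 := pow_le_one₀ (norm_nonneg x) (hL x List.mem_cons_self)
    have htail := ih fun y hy => hL y (List.mem_cons_of_mem x hy)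
    rw [ridge_cons, trace_add, trace_vecMulVec, dotProduct_ofLp_self, List.length_cons]
    push_cast
    linarith

theorem det_le_trace_pow_card {B : Matrix ι ι ℝ} (hB : B.PosSemidef) :
    B.det ≤ B.trace ^ Fintype.card ι := by
  rw [hB.isHermitian.det_eq_prod_eigenvalues, hB.isHermitian.trace_eq_sum_eigenvalues]
  rw [← Finset.card_univ, ← Finset.prod_const]
  refine Finset.prod_le_prod (fun i _ => hB.eigenvalues_nonneg i) fun i hi => ?_
  exact Finset.single_le_sum (f := hB.isHermitian.eigenvalues)
    (fun j _ => hB.eigenvalues_nonneg j) hi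

theorem det_ridge_le {lam : ℝ} (hlam : 0 < lam) {L : List (EuclideanSpace ℝ ι)}
    (hL : ∀ x ∈ L, ‖x‖ ≤ 1) :
    (ridge lam L).det ≤ (L.length + lam * Fintype.card ι) ^ Fintype.card ι := by
  have hS := (posDef_ridge hlam L).posSemidef
  exact (det_le_trace_pow_card hS).trans
    (pow_le_pow_left₀ hS.trace_nonneg (trace_ridge_le lam hL) _)

theorem dotProduct_ridge_mulVec (lam : ℝ) (L : List (EuclideanSpace ℝ ι)) (v u : ι → ℝ) :
    v ⬝ᵥ (ridge lam L *ᵥ u)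
      = (L.map fun x => (v ⬝ᵥ x.ofLp) * (x.ofLp ⬝ᵥ u)).sum + lam * (v ⬝ᵥ u) := by
  induction L with
  | nil => simp [ridge_nil, smul_mulVec]
  | cons x L ih =>
    rw [ridge_cons, add_mulVec, dotProduct_add, ih, vecMulVec_mulVec]
    simp [dotProduct_smul, add_assoc, mul_comm]

theorem dotProduct_eq_ridge {lam : ℝ} (hlam : 0 < lam) (L : List (EuclideanSpace ℝ ι))
    (v x : ι → ℝ) :
    v ⬝ᵥ x = (L.map fun z => (v ⬝ᵥ z.ofLp) * (z.ofLp ⬝ᵥ ((ridge lam L)⁻¹ *ᵥ x))).sum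
      + lam * (v ⬝ᵥ ((ridge lam L)⁻¹ *ᵥ x)) := by
  rw [← dotProduct_ridge_mulVec, mulVec_mulVec, mul_nonsing_inv _ (isUnit_det_ridge hlam L),
    one_mulVec]

theorem leverage_eq {lam : ℝ} (hlam : 0 < lam) (L : List (EuclideanSpace ℝ ι)) (x : ι → ℝ) :
    x ⬝ᵥ ((ridge lam L)⁻¹ *ᵥ x)
      = (L.map fun z => (z.ofLp ⬝ᵥ ((ridge lam L)⁻¹ *ᵥ x)) ^ 2).sum
        + lam * ‖WithLp.toLp 2 ((ridge lam L)⁻¹ *ᵥ x)‖ ^ 2 := by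
  rw [dotProduct_comm, dotProduct_eq_ridge hlam L, ← dotProduct_ofLp_self]
  simp only [dotProduct_comm _ (WithLp.ofLp _), sq]

/-- In the error of the ridge estimator at `x`, the residuals of the targets are weighted by
`z ⬝ᵥ Σ⁻¹ x`, and the regularization causes the bias `λ θ ⬝ᵥ Σ⁻¹ x`. -/
theorem ridge_error_eq {lam : ℝ} (hlam : 0 < lam) (Z : List (EuclideanSpace ℝ ι × ℝ))
    (θ x : ι → ℝ) :
    ((ridge lam (Z.map Prod.fst))⁻¹ *ᵥ (Z.map fun z => z.2 • z.1.ofLp).sum) ⬝ᵥ x - θ ⬝ᵥ x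
      = (Z.map fun z => (z.2 - θ ⬝ᵥ z.1.ofLp)
          * (z.1.ofLp ⬝ᵥ ((ridge lam (Z.map Prod.fst))⁻¹ *ᵥ x))).sum
        - lam * (θ ⬝ᵥ ((ridge lam (Z.map Prod.fst))⁻¹ *ᵥ x)) := by
  have hsymm : (ridge lam (Z.map Prod.fst))⁻¹ᵀ = (ridge lam (Z.map Prod.fst))⁻¹ := by
    rw [← conjTranspose_eq_transpose_of_trivial]
    exact (posDef_ridge hlam _).isHermitian.inv
  rw [dotProduct_eq_ridge hlam (Z.map Prod.fst) θ, dotProduct_comm, dotProduct_mulVec,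
    ← mulVec_transpose, hsymm, dotProduct_comm]
  clear hsymm
  generalize (ridge lam (Z.map Prod.fst))⁻¹ *ᵥ x = u
  induction Z with
  | nil => simp
  | cons z Z ih =>
    simp only [List.map_cons, List.sum_cons, add_dotProduct, smul_dotProduct, smul_eq_mul] at ih ⊢
    linarith

theorem abs_ridge_error_le {lam β : ℝ} (hlam : 0 < lam) (hβ : 0 ≤ β)
    (Z : List (EuclideanSpace ℝ ι × ℝ)) (θ : EuclideanSpace ℝ ι) {x : ι → ℝ}
    (hZ : ∀ z ∈ Z, |z.2 - θ.ofLp ⬝ᵥ z.1.ofLp| ≤ β)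
    (hx : x ⬝ᵥ ((ridge lam (Z.map Prod.fst))⁻¹ *ᵥ x) ≤ 1) :
    |((ridge lam (Z.map Prod.fst))⁻¹ *ᵥ (Z.map fun z => z.2 • z.1.ofLp).sum) ⬝ᵥ x
      - θ.ofLp ⬝ᵥ x| ≤ β * √Z.length + √lam * ‖θ‖ := by
  rw [leverage_eq hlam, List.map_map] at hx
  have hweights : 0 ≤ (Z.map fun z =>
      (z.1.ofLp ⬝ᵥ ((ridge lam (Z.map Prod.fst))⁻¹ *ᵥ x)) ^ 2).sum :=
    List.sum_nonneg (List.forall_mem_map.2 fun z _ => sq_nonneg _)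
  have hnorm : 0 ≤ lam * ‖WithLp.toLp 2 ((ridge lam (Z.map Prod.fst))⁻¹ *ᵥ x)‖ ^ 2 := by
    positivity
  rw [ridge_error_eq hlam]
  refine (abs_sub _ _).trans (add_le_add ?_ ?_)
  · exact abs_sum_mul_le_mul_sqrt_length Z hβ hZ (le_of_add_le_of_nonneg_left hx hnorm)
  · rw [abs_mul, abs_of_pos hlam]
    exact mul_abs_dotProduct_le_sqrt_mul_norm hlam.le θ (le_of_add_le_of_nonneg_right hx hweights)

end Ridge

/-! ## The smallest singular value -/

section SingularValues

section LinearMap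

variable {𝕜 E F : Type*} [RCLike 𝕜]
  [NormedAddCommGroup E] [InnerProductSpace 𝕜 E] [FiniteDimensional 𝕜 E]
  [NormedAddCommGroup F] [InnerProductSpace 𝕜 F] [FiniteDimensional 𝕜 F]

theorem norm_sq_map_eq_sum_eigenvalues (T : E →ₗ[𝕜] F) {n : ℕ} (hn : Module.finrank 𝕜 E = n)
    (v : E) :
    ‖T v‖ ^ 2 = ∑ i, T.isSymmetric_adjoint_comp_self.eigenvalues hn i
      * ‖(T.isSymmetric_adjoint_comp_self.eigenvectorBasis hn).repr v i‖ ^ 2 := by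
  set b := T.isSymmetric_adjoint_comp_self.eigenvectorBasis hn with hb
  have hinner : inner 𝕜 v ((LinearMap.adjoint T ∘ₗ T) v) = ((‖T v‖ ^ 2 : ℝ) : 𝕜) := by
    rw [LinearMap.comp_apply, LinearMap.adjoint_inner_right, inner_self_eq_norm_sq_to_K]
    norm_cast
  rw [← b.repr.inner_map_map, PiLp.inner_apply] at hinner
  simp only [hb, LinearMap.IsSymmetric.eigenvectorBasis_apply_self_apply, ← smul_eq_mul,
    inner_smul_right, inner_self_eq_norm_sq_to_K] at hinner
  simp only [smul_eq_mul] at hinner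
  exact_mod_cast hinner.symm

theorem singularValues_finrank_sub_one_mul_norm_le (T : E →ₗ[𝕜] F) (v : E) :
    T.singularValues (Module.finrank 𝕜 E - 1) * ‖v‖ ≤ ‖T v‖ := by
  set b := T.isSymmetric_adjoint_comp_self.eigenvectorBasis rfl
  have hσ : ∀ i, T.singularValues (Module.finrank 𝕜 E - 1) ^ 2
      ≤ T.isSymmetric_adjoint_comp_self.eigenvalues rfl i := fun i => by
    rw [← T.sq_singularValues_fin rfl]
    exact pow_le_pow_left₀ (T.singularValues_nonneg _)
      (T.singularValues_antitone (Nat.le_sub_one_of_lt i.2)) 2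
  refine le_of_sq_le_sq ?_ (norm_nonneg _)
  calc (T.singularValues (Module.finrank 𝕜 E - 1) * ‖v‖) ^ 2
      = ∑ i, T.singularValues (Module.finrank 𝕜 E - 1) ^ 2 * ‖b.repr v i‖ ^ 2 := by
        rw [mul_pow, ← b.repr.norm_map, EuclideanSpace.norm_sq_eq, Finset.mul_sum]
    _ ≤ ∑ i, T.isSymmetric_adjoint_comp_self.eigenvalues rfl i * ‖b.repr v i‖ ^ 2 :=
        Finset.sum_le_sum fun i _ => mul_le_mul_of_nonneg_right (hσ i) (sq_nonneg _)
    _ = ‖T v‖ ^ 2 := (norm_sq_map_eq_sum_eigenvalues T rfl v).symm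

theorem exists_inner_map_eq_of_mul_norm_le (T : E →ₗ[𝕜] F) {σ : ℝ} (hσ : 0 < σ)
    (hT : ∀ v, σ * ‖v‖ ≤ ‖T v‖) (w : E) :
    ∃ θ : F, ‖θ‖ ≤ ‖w‖ / σ ∧ ∀ v, inner 𝕜 θ (T v) = inner 𝕜 w v := by
  have hinj : Function.Injective T := (injective_iff_map_eq_zero T).2 fun v hv => by
    have := hT v
    rw [hv, norm_zero] at this
    exact norm_le_zero_iff.1 (nonpos_of_mul_nonpos_right this hσ)
  obtain ⟨u, rfl⟩ :=
    (LinearMap.injective_iff_surjective (f := LinearMap.adjoint T ∘ₗ T)).1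
      (T.adjoint_comp_self_injective_iff.2 hinj) w
  have hrepr : ∀ v, inner 𝕜 (T u) (T v) = inner 𝕜 ((LinearMap.adjoint T ∘ₗ T) u) v := fun v => by
    rw [LinearMap.comp_apply, LinearMap.adjoint_inner_left]
  refine ⟨T u, ?_, hrepr⟩
  generalize (LinearMap.adjoint T ∘ₗ T) u = w at hrepr ⊢
  rw [le_div_iff₀ hσ]
  have hsq : (‖T u‖ * σ) * (‖T u‖ * σ) ≤ ‖w‖ * (‖T u‖ * σ) :=
    calc (‖T u‖ * σ) * (‖T u‖ * σ)
        = σ ^ 2 * RCLike.re (inner 𝕜 w u) := by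
          rw [← hrepr, inner_self_eq_norm_sq]
          ring
      _ ≤ σ ^ 2 * (‖w‖ * ‖u‖) := by
          gcongr
          exact (RCLike.re_le_norm _).trans (norm_inner_le_norm w u)
      _ = ‖w‖ * (σ * ‖u‖ * σ) := by ring
      _ ≤ ‖w‖ * (‖T u‖ * σ) := by
          gcongr
          exact hT u
  by_contra! hlt
  exact hsq.not_gt (mul_lt_mul_of_pos_right hlt ((norm_nonneg w).trans_lt hlt))

end LinearMap

variable {d k : ℕ}

theorem smallestSingularValue_mul_norm_le (hkd : k ≤ d) (G : Matrix (Fin d) (Fin k) ℝ)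
    (v : EuclideanSpace ℝ (Fin k)) :
    smallestSingularValue G * ‖v‖ ≤ ‖Matrix.toEuclideanLin G v‖ := by
  rw [smallestSingularValue, min_eq_right hkd]
  simpa only [finrank_euclideanSpace_fin] using
    singularValues_finrank_sub_one_mul_norm_le (Matrix.toEuclideanLin G) v

theorem le_of_leftInverse {R : Type*} [CommRing R] [Nontrivial R] {G : Matrix (Fin d) (Fin k) R}
    {Gd : Matrix (Fin k) (Fin d) R} (h : Gd * G = 1) : k ≤ d := by
  simpa [h] using (Matrix.rank_mul_le_right Gd G).trans (Matrix.rank_le_height G)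

/-- A functional that is linear in the latent feature `φ` is linear in the embedding `G φ` of the
observations. -/
theorem exists_inner_toEuclideanLin_eq {H : ℕ} {G : ℕ → Matrix (Fin d) (Fin k) ℝ} {W : ℝ} {h : ℕ}
    (hh : h < H) (hη : (⨅ h : Fin H, smallestSingularValue (G h)) ≠ 0)
    (hG : ∃ Gd : Matrix (Fin k) (Fin d) ℝ, Gd * G h = 1) {w : EuclideanSpace ℝ (Fin k)}
    (hw : ‖w‖ ≤ W) :
    ∃ θ : EuclideanSpace ℝ (Fin d),
      ‖θ‖ ≤ W / (⨅ h : Fin H, smallestSingularValue (G h)) ∧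
      ∀ v, inner ℝ θ (Matrix.toEuclideanLin (G h) v) = inner ℝ w v := by
  obtain ⟨Gd, hGd⟩ := hG
  have hη_pos : 0 < ⨅ h : Fin H, smallestSingularValue (G h) :=
    (Real.iInf_nonneg fun _ => LinearMap.singularValues_nonneg _ _).lt_of_ne' hη
  have hη_le : (⨅ h : Fin H, smallestSingularValue (G h)) ≤ smallestSingularValue (G h) :=
    ciInf_le (Set.finite_range _).bddBelow (⟨h, hh⟩ : Fin H)
  obtain ⟨θ, hθ, hinner⟩ := exists_inner_map_eq_of_mul_norm_le (Matrix.toEuclideanLin (G h))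
    (hη_pos.trans_le hη_le) (smallestSingularValue_mul_norm_le (le_of_leftInverse hGd) (G h)) w
  refine ⟨θ, hθ.trans ?_, hinner⟩
  have hW : 0 ≤ W := (norm_nonneg w).trans hw
  gcongr

end SingularValues

/-! ## Sampling programs -/

section Sampling

/-- The iterated integral of a function of `M` successive samples of `μ`.  The function need not be
measurable, so this is not an integral with respect to a product measure. -/
noncomputable def iterLintegral {Ω : Type*} [MeasurableSpace Ω] (μ : Measure Ω) :
    ℕ → (List Ω → ℝ≥0∞) → ℝ≥0∞
  | 0, F => F []
  | M + 1, F => ∫⁻ ω, iterLintegral μ M (fun ωs => F (ω :: ωs)) ∂μ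

section Concentration

variable {Ω ι : Type*} [MeasurableSpace Ω] [Fintype ι] {μ : Measure Ω}

theorem le_iterLintegral_of_sum_prod [IsProbabilityMeasure μ] {Z : ι → Ω → ℝ≥0∞}
    (hZ : ∀ i, Measurable (Z i)) {ρ : ι → ℝ≥0∞} (hρ : ∀ i, ∫⁻ ω, Z i ω ∂μ ≤ ρ i) (w : ℝ≥0∞)
    (M : ℕ) (K : ι → ℝ≥0∞) (F : List Ω → ℝ≥0∞)
    (hF : ∀ ωs, ωs.length = M → w * (1 - ∑ i, K i * (ωs.map (Z i)).prod) ≤ F ωs) :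
    w * (1 - ∑ i, K i * ρ i ^ M) ≤ iterLintegral μ M F := by
  induction M generalizing K F with
  | zero => simpa [iterLintegral] using hF [] rfl
  | succ M ih =>
    have hmeas : ∀ i, Measurable fun ω => K i * Z i ω * ρ i ^ M := fun i =>
      ((hZ i).const_mul _).mul_const _
    have hintegral : ∫⁻ ω, ∑ i, K i * Z i ω * ρ i ^ M ∂μ ≤ ∑ i, K i * ρ i ^ (M + 1) := by
      rw [lintegral_finsetSum _ fun i _ => hmeas i]
      refine Finset.sum_le_sum fun i _ => ?_
      rw [lintegral_mul_const _ ((hZ i).const_mul _), lintegral_const_mul _ (hZ i), pow_succ',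
        ← mul_assoc]
      gcongr
      exact hρ i
    calc w * (1 - ∑ i, K i * ρ i ^ (M + 1))
        ≤ w * (∫⁻ _, 1 ∂μ - ∫⁻ ω, ∑ i, K i * Z i ω * ρ i ^ M ∂μ) := by
          rw [lintegral_one, measure_univ]
          gcongr
      _ ≤ w * ∫⁻ ω, (1 - ∑ i, K i * Z i ω * ρ i ^ M) ∂μ := by
          gcongr
          exact lintegral_sub_le _ _ (Finset.measurable_sum _ fun i _ => hmeas i)
      _ ≤ ∫⁻ ω, w * (1 - ∑ i, K i * Z i ω * ρ i ^ M) ∂μ := lintegral_const_mul_le _ _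
      _ ≤ iterLintegral μ (M + 1) F := lintegral_mono fun ω => by
          refine ih (fun i => K i * Z i ω) _ fun ωs hωs => ?_
          simpa only [List.map_cons, List.prod_cons, mul_assoc] using
            hF (ω :: ωs) (by rw [List.length_cons, hωs])

theorem lintegral_exp_le_of_hasSubgaussianMGF {X : Ω → ℝ} {c : NNReal}
    (hX : HasSubgaussianMGF X c μ) {e : ℝ} (hc : c ≠ 0) :
    ∫⁻ ω, ENNReal.ofReal (Real.exp (e / c * (X ω - e))) ∂μ
      ≤ ENNReal.ofReal (Real.exp (-(e ^ 2 / (2 * c)))) := by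
  have hc' : (c : ℝ) ≠ 0 := NNReal.coe_ne_zero.2 hc
  simp_rw [mul_sub, Real.exp_sub]
  rw [← ofReal_integral_eq_lintegral_ofReal ((hX.integrable_exp_mul _).div_const _)
    (Filter.Eventually.of_forall fun ω => by positivity), integral_div]
  refine ENNReal.ofReal_le_ofReal ?_
  rw [div_le_iff₀ (Real.exp_pos _), ← Real.exp_add]
  refine (hX.mgf_le (e / c)).trans_eq (congrArg Real.exp ?_)
  field_simp
  ring

theorem prod_map_ofReal_exp {α : Type*} (X : α → ℝ) (t e : ℝ) (L : List α) :
    (L.map fun x => ENNReal.ofReal (Real.exp (t * (X x - e)))).prod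
      = ENNReal.ofReal (Real.exp (t * ((L.map X).sum - L.length * e))) := by
  induction L with
  | nil => simp
  | cons x L ih =>
    rw [List.map_cons, List.prod_cons, ih, ← ENNReal.ofReal_mul (Real.exp_nonneg _),
      ← Real.exp_add, List.map_cons, List.sum_cons, List.length_cons]
    push_cast
    ring_nf

/-- Chernoff's method.  Unlike for a measure of a bad event, `F` need not be measurable. -/
theorem le_iterLintegral_of_hasSubgaussianMGF [IsProbabilityMeasure μ] {X : ι → Ω → ℝ}
    (hX : ∀ i, Measurable (X i)) {c : NNReal} (hsub : ∀ i, HasSubgaussianMGF (X i) c μ)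
    (hc : c ≠ 0) {e : ℝ} (he : 0 ≤ e) (w : ℝ≥0∞) (M : ℕ) (F : List Ω → ℝ≥0∞)
    (hF : ∀ ωs, ωs.length = M → (∀ i, (ωs.map (X i)).sum ≤ M * e) → w ≤ F ωs) :
    w * (1 - ENNReal.ofReal (Fintype.card ι * Real.exp (-(M * (e ^ 2 / (2 * c))))))
      ≤ iterLintegral μ M F := by
  have hsum : ENNReal.ofReal (Fintype.card ι * Real.exp (-(M * (e ^ 2 / (2 * c)))))
      = ∑ _i : ι, 1 * ENNReal.ofReal (Real.exp (-(e ^ 2 / (2 * c)))) ^ M := by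
    rw [Finset.sum_const, Finset.card_univ, nsmul_eq_mul, one_mul,
      ← ENNReal.ofReal_pow (Real.exp_nonneg _), ← Real.exp_nat_mul, mul_neg,
      ENNReal.ofReal_mul (Nat.cast_nonneg _), ENNReal.ofReal_natCast]
  rw [hsum]
  refine le_iterLintegral_of_sum_prod
    (Z := fun i ω => ENNReal.ofReal (Real.exp (e / c * (X i ω - e))))
    (fun i => by have := hX i; fun_prop)
    (fun i => lintegral_exp_le_of_hasSubgaussianMGF (hsub i) hc) w M _ F fun ωs hωs => ?_
  by_cases hgood : ∀ i, (ωs.map (X i)).sum ≤ M * e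
  · exact (mul_le_of_le_one_right' tsub_le_self).trans (hF ωs hωs hgood)
  · push Not at hgood
    obtain ⟨i, hi⟩ := hgood
    have hone : (1 : ℝ≥0∞)
        ≤ ∑ i, 1 * (ωs.map fun ω => ENNReal.ofReal (Real.exp (e / c * (X i ω - e)))).prod := by
      refine le_trans ?_ (Finset.single_le_sum (fun _ _ => zero_le) (Finset.mem_univ i))
      rw [one_mul, prod_map_ofReal_exp, ENNReal.one_le_ofReal, hωs]
      exact Real.one_le_exp (mul_nonneg (by positivity) (sub_nonneg.2 hi.le))
    rw [tsub_eq_zero_of_le hone, mul_zero]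
    exact zero_le

theorem sum_map_sub_const {α : Type*} (f : α → ℝ) (b : ℝ) (L : List α) :
    (L.map fun x => f x - b).sum = (L.map f).sum - L.length * b := by
  simp [sub_eq_add_neg, List.sum_map_add]

theorem le_iterLintegral_of_abs_mean_sub_le [IsProbabilityMeasure μ] {g : ι → Ω → ℝ}
    (hg : ∀ i, Measurable (g i)) {c : NNReal}
    (hsub : ∀ i, HasSubgaussianMGF (fun ω => g i ω - ∫ x, g i x ∂μ) c μ) (hc : c ≠ 0)
    {e : ℝ} (he : 0 ≤ e) (w : ℝ≥0∞) {M : ℕ} (hM : 0 < M) (F : List Ω → ℝ≥0∞)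
    (hF : ∀ ωs, ωs.length = M →
      (∀ i, |(M : ℝ)⁻¹ * (ωs.map (g i)).sum - ∫ x, g i x ∂μ| ≤ e) → w ≤ F ωs) :
    w * (1 - ENNReal.ofReal (2 * Fintype.card ι * Real.exp (-(M * (e ^ 2 / (2 * c))))))
      ≤ iterLintegral μ M F := by
  set X : ι → Ω → ℝ := fun i ω => g i ω - ∫ x, g i x ∂μ with hX
  have hXm : ∀ i, Measurable (X i) := fun i => (hg i).sub_const _
  have key := le_iterLintegral_of_hasSubgaussianMGF (X := Sum.elim X fun i => -X i)
    (by rintro (i | i); exacts [hXm i, (hXm i).neg])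
    (by rintro (i | i); exacts [hsub i, (hsub i).neg]) hc he w M F fun ωs hωs hsum => ?_
  · rwa [Fintype.card_sum, Nat.cast_add, ← two_mul] at key
  refine hF ωs hωs fun i => ?_
  have hM' : (0 : ℝ) < M := Nat.cast_pos.2 hM
  have hupper : (ωs.map (X i)).sum ≤ M * e := hsum (Sum.inl i)
  have hlower : -(ωs.map (X i)).sum ≤ M * e := by
    rw [List.sum_neg, List.map_map]
    exact hsum (Sum.inr i)
  have hmean : (M : ℝ)⁻¹ * (ωs.map (g i)).sum - ∫ x, g i x ∂μ
      = (M : ℝ)⁻¹ * (ωs.map (X i)).sum := by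
    rw [hX, sum_map_sub_const, hωs]
    field_simp
  rw [hmean, abs_mul, abs_of_pos (inv_pos.2 hM'), inv_mul_le_iff₀ hM', abs_le']
  exact ⟨hupper, hlower⟩

end Concentration

variable {S A O : Type*} [MeasurableSpace S] [MeasurableSpace O]

namespace Prog

variable {P : POMDP S A O} {α β : Type*}

theorem expect_bind (f : β → ℕ → ℝ≥0∞) (q : Prog A O α) (g : α → Prog A O β) (n : ℕ) :
    (q.bind g).expect P f n = q.expect P (fun x m => (g x).expect P f m) n := by
  induction q generalizing n with
  | ret x => rfl
  | observe l k ih => exact lintegral_congr fun o => ih o (n + 1)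
  | reward l a k ih => exact lintegral_congr fun y => ih y (n + 1)

theorem expect_mono {f g : α → ℕ → ℝ≥0∞} (hfg : ∀ x n, f x n ≤ g x n) (q : Prog A O α) (n : ℕ) :
    q.expect P f n ≤ q.expect P g n := by
  induction q generalizing n with
  | ret x => exact hfg x n
  | observe l k ih => exact lintegral_mono fun o => ih o (n + 1)
  | reward l a k ih => exact lintegral_mono fun y => ih y (n + 1)

theorem prob_mono {E F : α → ℕ → Prop} (hEF : ∀ x n, E x n → F x n) (q : Prog A O α) :
    q.prob P E ≤ q.prob P F := by
  refine expect_mono (fun x n => ?_) q 0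
  split_ifs with hE hF
  exacts [le_rfl, absurd (hEF x n hE) hF, zero_le, le_rfl]

/-- The program `q` executes one episode and returns a sample of `μ`. -/
def Samples (P : POMDP S A O) (q : Prog A O α) [MeasurableSpace α] (μ : Measure α) : Prop :=
  ∀ (f : α → ℕ → ℝ≥0∞) (n : ℕ), q.expect P f n = ∫⁻ x, f x (n + 1) ∂μ

theorem Samples.expect_replicate [MeasurableSpace α] {q : Prog A O α} {μ : Measure α}
    (hq : q.Samples P μ) (f : List α → ℕ → ℝ≥0∞) (M n : ℕ) :
    (replicate M q).expect P f n = iterLintegral μ M (fun xs => f xs (n + M)) := by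
  induction M generalizing n f with
  | zero => rfl
  | succ M ih =>
    rw [replicate, expect_bind, hq]
    refine lintegral_congr fun x => ?_
    rw [expect_bind, ih]
    simp only [expect, add_assoc, add_comm 1 M]

end Prog

/-- `q` ends in a result `x`, after a multiple `j * M` of `M` episodes, such that `Q x j` holds,
up to failures that cost a factor `s` per `M` episodes in the probability of what is to come. -/
def Ensures (P : POMDP S A O) (M : ℕ) (s : ℝ≥0∞) {α : Type*} (q : Prog A O α)
    (Q : α → ℕ → Prop) : Prop :=
  ∀ (f : α → ℕ → ℝ≥0∞) (n : ℕ) (w : ℝ≥0∞),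
    (∀ x j, Q x j → w * s ^ j ≤ f x (n + j * M)) → w ≤ q.expect P f n

namespace Ensures

variable {P : POMDP S A O} {M : ℕ} {s : ℝ≥0∞} {α β : Type*}

theorem ret {x : α} {Q : α → ℕ → Prop} (h : Q x 0) : Ensures P M s (Prog.ret x) Q := by
  intro f n w hf
  simpa [Prog.expect] using hf x 0 h

theorem mono {q : Prog A O α} {Q R : α → ℕ → Prop} (h : Ensures P M s q Q)
    (hQR : ∀ x j, Q x j → R x j) : Ensures P M s q R :=
  fun f n w hf => h f n w fun x j hx => hf x j (hQR x j hx)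

theorem bind {q : Prog A O α} {g : α → Prog A O β} {Q : α → ℕ → Prop} {R : β → ℕ → Prop}
    (h : Ensures P M s q Q) (hg : ∀ x j, Q x j → Ensures P M s (g x) fun y k => R y (j + k)) :
    Ensures P M s (q.bind g) R := by
  intro f n w hf
  rw [Prog.expect_bind]
  refine h _ n w fun x j hx => hg x j hx f _ _ fun y k hy => ?_
  rw [mul_assoc, ← pow_add, add_assoc, ← add_mul]
  exact hf y (j + k) hy

theorem replicate [MeasurableSpace α] {ι : Type*} [Fintype ι] {q : Prog A O α} {μ : Measure α}
    [IsProbabilityMeasure μ] (hq : q.Samples P μ) {g : ι → α → ℝ} (hg : ∀ i, Measurable (g i))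
    {c : NNReal} (hsub : ∀ i, HasSubgaussianMGF (fun x => g i x - ∫ y, g i y ∂μ) c μ) (hc : c ≠ 0)
    {e : ℝ} (he : 0 ≤ e) (hM : 0 < M)
    (hs : 1 ≤ s * (1 - ENNReal.ofReal
      (2 * Fintype.card ι * Real.exp (-(M * (e ^ 2 / (2 * c))))))) :
    Ensures P M s (Prog.replicate M q) fun xs j => j = 1 ∧ xs.length = M ∧
      ∀ i, |(M : ℝ)⁻¹ * (xs.map (g i)).sum - ∫ x, g i x ∂μ| ≤ e := by
  intro f n w hf
  rw [hq.expect_replicate]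
  refine le_trans ?_ (le_iterLintegral_of_abs_mean_sub_le hg hsub hc he (w * s) hM _
    fun xs hxs hgood => ?_)
  · rw [mul_assoc]
    exact le_mul_of_one_le_right' hs
  · simpa only [pow_one, one_mul] using hf xs 1 ⟨rfl, hxs, hgood⟩

end Ensures

theorem inner_smul_sum_map {E α : Type*} [NormedAddCommGroup E] [InnerProductSpace ℝ E]
    (ψ : α → E) (r : ℝ) (L : List α) (θ : E) :
    inner ℝ θ (r • (L.map ψ).sum) = r * (L.map fun x => inner ℝ θ (ψ x)).sum := by
  rw [inner_smul_right, ← innerSL_apply_apply, map_list_sum, List.map_map]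
  rfl

theorem norm_mean_le_one {E α : Type*} [SeminormedAddCommGroup E] [NormedSpace ℝ E] {ψ : α → E}
    (hψ : ∀ x, ‖ψ x‖ ≤ 1) (L : List α) :
    ‖(L.length : ℝ)⁻¹ • (L.map ψ).sum‖ ≤ 1 := by
  have hsum : ‖(L.map ψ).sum‖ ≤ L.length := by
    induction L with
    | nil => simp
    | cons x L ih =>
      rw [List.map_cons, List.sum_cons, List.length_cons, Nat.cast_succ, add_comm]
      exact (norm_add_le _ _).trans (add_le_add ih (hψ x)) |>.trans_eq' (by rw [add_comm])
  rw [norm_smul, norm_inv, Real.norm_natCast]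
  exact inv_mul_le_one_of_le₀ hsum (Nat.cast_nonneg _)

theorem ensures_estFeature {d : ℕ} {ι : Type*} [Fintype ι] (P : POMDP S A O) (c : Params A O d)
    (l : List A) [IsProbabilityMeasure (P.obsLaw l)] (hψ : Measurable c.ψ)
    (hψ1 : ∀ o, ‖c.ψ o‖ ≤ 1) (hM : 0 < c.M) {θ : ι → EuclideanSpace ℝ (Fin d)} {Θ e : ℝ}
    (hΘ : 0 < Θ) (he : 0 ≤ e) (hθ : ∀ i, ‖θ i‖ ≤ Θ) {s : ℝ≥0∞}
    (hs : 1 ≤ s * (1 - ENNReal.ofReal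
      (2 * Fintype.card ι * Real.exp (-(c.M * (e ^ 2 / (2 * Θ ^ 2))))))) :
    Ensures P c.M s (estFeature c l) fun x j => j = 1 ∧ ‖x‖ ≤ 1 ∧
      ∀ i, |inner ℝ (θ i) x - ∫ o, inner ℝ (θ i) (c.ψ o) ∂(P.obsLaw l)| ≤ e := by
  lift Θ to NNReal using hΘ.le
  have hmeas : ∀ i, Measurable fun o => inner ℝ (θ i) (c.ψ o) := fun i =>
    measurable_const.inner hψ
  have hbound : ∀ i o, inner ℝ (θ i) (c.ψ o) ∈ Set.Icc (-(Θ : ℝ)) Θ := fun i o =>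
    abs_le.1 <| (abs_real_inner_le_norm _ _).trans <|
      (mul_le_of_le_one_right (norm_nonneg _) (hψ1 o)).trans (hθ i)
  have hsub : ∀ i, HasSubgaussianMGF (fun o => inner ℝ (θ i) (c.ψ o)
      - ∫ o', inner ℝ (θ i) (c.ψ o') ∂(P.obsLaw l)) (Θ ^ 2) (P.obsLaw l) := fun i => by
    have hwidth : (‖(Θ : ℝ) - -Θ‖₊ / 2) ^ 2 = Θ ^ 2 := by
      rw [sub_neg_eq_add, ← two_mul, nnnorm_mul]
      simp
    rw [← hwidth]
    exact hasSubgaussianMGF_of_mem_Icc (hmeas i).aemeasurable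
      (Filter.Eventually.of_forall (hbound i))
  refine (Ensures.replicate (fun _ _ => rfl) hmeas hsub (by simpa using hΘ.ne') he hM
    (by simpa only [NNReal.coe_pow] using hs)).bind fun os j ⟨hj, hos, hgood⟩ => Ensures.ret
    ⟨hj, hos ▸ norm_mean_le_one hψ1 os, fun i => ?_⟩
  rw [inner_smul_sum_map]
  exact hgood i

theorem ensures_estReward {d : ℕ} (P : POMDP S A O) (c : Params A O d) (l : List A) (a : A)
    [IsProbabilityMeasure (P.rewLaw l a)]
    (hr : ∀ᵐ y ∂(P.rewLaw l a), y ∈ Set.Icc (0 : ℝ) 1)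
    (hM : 0 < c.M) {e : ℝ} (he : 0 ≤ e) {s : ℝ≥0∞}
    (hs : 1 ≤ s * (1 - ENNReal.ofReal (2 * Real.exp (-(c.M * (2 * e ^ 2)))))) :
    Ensures P c.M s (estReward c l a) fun y j => j = 1 ∧
      |y - ∫ z, z ∂(P.rewLaw l a)| ≤ e := by
  have hsub : HasSubgaussianMGF (fun y => y - ∫ z, z ∂(P.rewLaw l a)) (1 / 4) (P.rewLaw l a) := by
    have hwidth : (‖(1 : ℝ) - 0‖₊ / 2) ^ 2 = 1 / 4 := by
      rw [sub_zero, nnnorm_one]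
      norm_num
    rw [← hwidth]
    exact hasSubgaussianMGF_of_mem_Icc aemeasurable_id' hr
  have hexponent : e ^ 2 / (2 * ((1 / 4 : NNReal) : ℝ)) = 2 * e ^ 2 := by
    push_cast
    ring
  refine (Ensures.replicate (ι := Unit) (fun _ _ => rfl) (fun _ => measurable_id')
    (fun _ => hsub) (by simp) he hM ?_).bind
    fun ys j ⟨hj, _, hgood⟩ => Ensures.ret ⟨hj, by simpa using hgood ()⟩
  rwa [hexponent, Fintype.card_unit, Nat.cast_one, mul_one]

end Sampling

/-! ## The recursion of the algorithm -/

section Analysis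

open Matrix

variable {S A O : Type*} [MeasurableSpace S] [MeasurableSpace O] {d : ℕ}

theorem abs_sup'_sub_sup'_le {ι : Type*} {t : Finset ι} (ht : t.Nonempty) {f g : ι → ℝ} {e : ℝ}
    (h : ∀ i ∈ t, |f i - g i| ≤ e) : |t.sup' ht f - t.sup' ht g| ≤ e := by
  rw [abs_sub_le_iff, sub_le_iff_le_add, sub_le_iff_le_add]
  constructor <;> refine Finset.sup'_le _ _ fun i hi => ?_
  · linarith [(abs_sub_le_iff.1 (h i hi)).1, Finset.le_sup' g hi]
  · linarith [(abs_sub_le_iff.1 (h i hi)).2, Finset.le_sup' f hi]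

theorem abs_add_sub_add_le {a b a' b' e e' : ℝ} (h : |a - a'| ≤ e) (h' : |b - b'| ≤ e') :
    |a + b - (a' + b')| ≤ e + e' := by
  rw [add_sub_add_comm]
  exact (abs_add_le _ _).trans (add_le_add h h')

namespace Data

/-- The number of features that have been stored below the horizon. -/
def size (D : Data A d) (H : ℕ) : ℕ := ∑ h ∈ Finset.range H, (D.feats h).length

theorem feats_addFeat_self (D : Data A d) (h : ℕ) (x : EuclideanSpace ℝ (Fin d)) :
    (D.addFeat h x).feats h = D.feats h ++ [x] :=
  Function.update_self _ _ _

theorem feats_addFeat_of_ne (D : Data A d) {h k : ℕ} (hk : k ≠ h) (x : EuclideanSpace ℝ (Fin d)) :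
    (D.addFeat h x).feats k = D.feats k :=
  Function.update_of_ne hk _ _

theorem size_addFeat (D : Data A d) {h H : ℕ} (hh : h < H) (x : EuclideanSpace ℝ (Fin d)) :
    (D.addFeat h x).size H = D.size H + 1 := by
  have hmem : h ∈ Finset.range H := Finset.mem_range.2 hh
  rw [size, size, ← Finset.add_sum_erase _ _ hmem, ← Finset.add_sum_erase _ _ hmem,
    feats_addFeat_self, List.length_append, List.length_singleton, add_right_comm]
  congr 2
  exact Finset.sum_congr rfl fun k hk => by rw [feats_addFeat_of_ne D (Finset.ne_of_mem_erase hk)]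

theorem pairs_addPair_self (D : Data A d) (a : A) (h : ℕ) (x : EuclideanSpace ℝ (Fin d)) (y : ℝ) :
    (D.addPair a h x y).pairs a h = D.pairs a h ++ [(x, y)] :=
  if_pos ⟨rfl, rfl⟩

theorem pairs_addPair_of_action_ne (D : Data A d) {a b : A} (hb : b ≠ a) (h k : ℕ)
    (x : EuclideanSpace ℝ (Fin d)) (y : ℝ) : (D.addPair a h x y).pairs b k = D.pairs b k :=
  if_neg fun hab => hb hab.1

theorem pairs_addPair_of_level_ne (D : Data A d) (a b : A) {h k : ℕ} (hk : k ≠ h)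
    (x : EuclideanSpace ℝ (Fin d)) (y : ℝ) : (D.addPair a h x y).pairs b k = D.pairs b k :=
  if_neg fun hkh => hk hkh.2

theorem two_mul_det_ridge_le {lam : ℝ} (hlam : 0 < lam) {D : Data A d} {h : ℕ}
    {x : EuclideanSpace ℝ (Fin d)} (hx : 1 < D.invNorm lam h x) :
    2 * (ridge lam (D.feats h)).det ≤ (ridge lam (D.feats h ++ [x])).det := by
  rw [Data.invNorm, Real.lt_sqrt zero_le_one, one_pow, Data.Sig_eq_ridge] at hx
  rw [det_ridge_append_singleton hlam, mul_comm]
  gcongr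
  · exact (posDef_ridge hlam _).det_pos.le
  · linarith

/-- The data sets of level `h` agree. -/
structure SameLevel (D D' : Data A d) (h : ℕ) : Prop where
  feats_eq : D'.feats h = D.feats h
  pairs_eq : ∀ a, D'.pairs a h = D.pairs a h

theorem SameLevel.refl (D : Data A d) (h : ℕ) : SameLevel D D h := ⟨rfl, fun _ => rfl⟩

theorem SameLevel.trans {D D' D'' : Data A d} {h : ℕ} (hD : SameLevel D D' h)
    (hD' : SameLevel D' D'' h) : SameLevel D D'' h :=
  ⟨hD'.feats_eq.trans hD.feats_eq, fun a => (hD'.pairs_eq a).trans (hD.pairs_eq a)⟩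

theorem sameLevel_addPair (D : Data A d) (a : A) {h k : ℕ} (hk : k ≠ h)
    (x : EuclideanSpace ℝ (Fin d)) (y : ℝ) : SameLevel D (D.addPair a h x y) k :=
  ⟨rfl, fun b => pairs_addPair_of_level_ne D a b hk x y⟩

theorem sameLevel_addFeat (D : Data A d) {h k : ℕ} (hk : k ≠ h) (x : EuclideanSpace ℝ (Fin d)) :
    SameLevel D (D.addFeat h x) k :=
  ⟨feats_addFeat_of_ne D hk x, fun _ => rfl⟩

/-- The effect at level `h` of the loop of a bad event with feature `x` over the actions `as`: it
updates the targets `y` to `y'`, and for every action of `as` it stores `x` with its target. -/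
structure Explored (h : ℕ) (x : EuclideanSpace ℝ (Fin d)) (as : List A) (y : A → ℝ) (D : Data A d)
    (y' : A → ℝ) (D' : Data A d) : Prop where
  feats_eq : D'.feats h = D.feats h
  pairs_of_mem : ∀ b ∈ as, D'.pairs b h = D.pairs b h ++ [(x, y' b)]
  pairs_of_notMem : ∀ b ∉ as, D'.pairs b h = D.pairs b h
  target_of_notMem : ∀ b ∉ as, y' b = y b

theorem Explored.nil (h : ℕ) (x : EuclideanSpace ℝ (Fin d)) (y : A → ℝ) (D : Data A d) :
    Explored h x [] y D y D :=
  ⟨rfl, fun _ hb => absurd hb List.not_mem_nil, fun _ _ => rfl, fun _ _ => rfl⟩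

theorem Explored.cons [DecidableEq A] {h : ℕ} {x : EuclideanSpace ℝ (Fin d)} {a : A} {as : List A}
    (ha : a ∉ as) {y y' : A → ℝ} {t : ℝ} {D D₁ D' : Data A d} (hD : SameLevel D D₁ h)
    (hE : Explored h x as (Function.update y a t) (D₁.addPair a h x t) y' D') :
    Explored h x (a :: as) y D y' D' where
  feats_eq := hE.feats_eq.trans hD.feats_eq
  pairs_of_mem b hb := by
    by_cases hba : b = a
    · subst hba
      rw [hE.pairs_of_notMem b ha, hE.target_of_notMem b ha, Function.update_self,
        pairs_addPair_self, hD.pairs_eq]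
    · rw [hE.pairs_of_mem b (List.mem_of_ne_of_mem hba hb), pairs_addPair_of_action_ne _ hba,
        hD.pairs_eq]
  pairs_of_notMem b hb := by
    obtain ⟨hba, hb⟩ := not_or.1 (List.mem_cons.not.1 hb)
    rw [hE.pairs_of_notMem b hb, pairs_addPair_of_action_ne _ hba, hD.pairs_eq]
  target_of_notMem b hb := by
    obtain ⟨hba, hb⟩ := not_or.1 (List.mem_cons.not.1 hb)
    rw [hE.target_of_notMem b hb, Function.update_of_ne hba]

end Data

open Data

/-- The total reward collected along `t` after `l`. -/
def pathReward (r : List A → A → ℝ) : List A → List A → ℝ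
  | _, [] => 0
  | l, a :: t => r l a + pathReward r (l ++ [a]) t

/-- An upper bound on the number of estimates per stored feature. -/
def exploreCost (A H : ℕ) : ℕ := A * (1 + 2 * H + A)

/-- An upper bound on the number of estimates of the algorithm, when at most `n₀` features are
stored at each level. -/
def estimateBound (A H n₀ : ℕ) : ℕ := H + (exploreCost A H + H) * (H * n₀)

/-- What the analysis of the algorithm uses: values of action sequences that satisfy the Bellman
equation with a gap and are predicted by linear functions of the mean features, accurate estimators,
and suitable parameters.  The factor `s` is the price of an estimate in `Ensures`. -/
structure AccurateModel [Fintype A] [Nonempty A] (P : POMDP S A O) (c : Params A O d)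
    (s : ℝ≥0∞) where
  /-- the optimal value after an action sequence -/
  V : List A → ℝ
  /-- the optimal value after an action sequence and one more action -/
  Q : List A → A → ℝ
  /-- the mean reward of an action after an action sequence -/
  r : List A → A → ℝ
  /-- the parameter with which the features predict `Q` -/
  θ : A → ℕ → EuclideanSpace ℝ (Fin d)
  /-- a bound for the parameters `θ` -/
  Θ : ℝ
  /-- a lower bound for the positive gaps -/
  Δ : ℝ
  /-- the accuracy of the estimated rewards -/
  er : ℝ
  /-- the accuracy of the predictions by the estimated features -/
  ef : ℝ
  /-- a bound for the number of features that are stored at one level -/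
  n₀ : ℕ
  lam_pos : 0 < c.lam
  eps_eq : c.ε = 1
  er_nonneg : 0 ≤ er
  ef_nonneg : 0 ≤ ef
  argmax_le : ∀ (f : A → ℝ) (a : A), f a ≤ f (c.argmax f)
  reward : ∀ l a, l.length < c.H →
    Ensures P c.M s (estReward c l a) fun y j => j = 1 ∧ |y - r l a| ≤ er
  feature : ∀ l, l.length < c.H → Ensures P c.M s (estFeature c l) fun x j =>
    j = 1 ∧ ‖x‖ ≤ 1 ∧ ∀ a, |inner ℝ (θ a l.length) x - Q l a| ≤ ef
  Q_eq : ∀ l a, l.length < c.H → Q l a = r l a + V (l ++ [a])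
  V_eq : ∀ l, l.length < c.H → V l = Finset.univ.sup' Finset.univ_nonempty (Q l)
  V_end : ∀ l, l.length = c.H → V l = 0
  gap : ∀ l a, l.length < c.H → 0 < V l - Q l a → Δ ≤ V l - Q l a
  norm_le : ∀ a h, h < c.H → ‖θ a h‖ ≤ Θ
  card_le : ∀ n : ℕ, 2 ^ n * c.lam ^ d ≤ (n + c.lam * d) ^ d → n ≤ n₀
  accuracy : √c.lam * Θ + (c.H * er + ef) * √n₀ + ef < Δ / 2

namespace AccurateModel

variable [Fintype A] [Nonempty A] {P : POMDP S A O} {c : Params A O d} {s : ℝ≥0∞}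
  (m : AccurateModel P c s)

/-- The accuracy of the regression targets as values of the linear predictors: a target adds up at
most `H` estimated rewards, and the stored feature is itself an estimate. -/
def targetError : ℝ := c.H * m.er + m.ef

theorem targetError_nonneg : 0 ≤ m.targetError :=
  add_nonneg (mul_nonneg (Nat.cast_nonneg _) m.er_nonneg) m.ef_nonneg

/-- The vector `x` is an accurate estimate of the mean feature after `l`. -/
structure AccurateFeature (l : List A) (x : EuclideanSpace ℝ (Fin d)) : Prop where
  norm_le_one : ‖x‖ ≤ 1
  abs_inner_sub_le : ∀ a, |inner ℝ (m.θ a l.length) x - m.Q l a| ≤ m.ef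

theorem ensures_accurateFeature {l : List A} (hl : l.length < c.H) :
    Ensures P c.M s (estFeature c l) fun x j => j = 1 ∧ m.AccurateFeature l x :=
  (m.feature l hl).mono fun _ _ ⟨hj, hnorm, herr⟩ => ⟨hj, hnorm, herr⟩

/-- The invariant that the data sets of level `h` satisfy when no bad event is being handled there.
Each stored feature has doubled the determinant of `Σ_h`. -/
structure GoodLevel (D : Data A d) (h : ℕ) : Prop where
  norm_le_one : ∀ x ∈ D.feats h, ‖x‖ ≤ 1
  le_det : 2 ^ (D.feats h).length * c.lam ^ d ≤ (ridge c.lam (D.feats h)).det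
  pairs_fst : ∀ a, (D.pairs a h).map Prod.fst = D.feats h
  pairs_error : ∀ a, ∀ z ∈ D.pairs a h, |z.2 - inner ℝ (m.θ a h) z.1| ≤ m.targetError

/-- All levels from `h` on are good. -/
def GoodFrom (h : ℕ) (D : Data A d) : Prop := ∀ k, h ≤ k → m.GoodLevel D k

/-- A computation with `j` estimates turns `D` into `D'`, changing only levels from `h` on and
leaving levels from `h'` on good.  The number `j` exceeds `b` by at most the amortized cost of the
features that it has stored. -/
structure Update (h h' : ℕ) (D D' : Data A d) (j b : ℕ) : Prop where
  sameLevel : ∀ k < h, SameLevel D D' k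
  goodFrom : m.GoodFrom h' D'
  size_le : D.size c.H ≤ D'.size c.H
  cost_le : j + exploreCost (Fintype.card A) c.H * D.size c.H
    ≤ b + exploreCost (Fintype.card A) c.H * D'.size c.H

variable {m}

theorem GoodLevel.of_sameLevel {D D' : Data A d} {h : ℕ} (hD : m.GoodLevel D h)
    (hsame : SameLevel D D' h) : m.GoodLevel D' h where
  norm_le_one := hsame.feats_eq ▸ hD.norm_le_one
  le_det := hsame.feats_eq ▸ hD.le_det
  pairs_fst a := by rw [hsame.feats_eq, hsame.pairs_eq, hD.pairs_fst]
  pairs_error a := hsame.pairs_eq a ▸ hD.pairs_error a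

theorem GoodFrom.of_sameLevel {D D' : Data A d} {h h' : ℕ} (hD : m.GoodFrom h D)
    (hD' : m.GoodFrom h' D') (hsame : ∀ k < h', SameLevel D D' k) : m.GoodFrom h D' := fun k hk =>
  (lt_or_ge k h').elim (fun hkh' => (hD k hk).of_sameLevel (hsame k hkh')) (hD' k)

theorem goodLevel_empty (h : ℕ) : m.GoodLevel Data.empty h where
  norm_le_one := fun _ hx => absurd hx List.not_mem_nil
  le_det := by simp [Data.empty, ridge_nil]
  pairs_fst := fun _ => rfl
  pairs_error := fun _ _ hz => absurd hz List.not_mem_nil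

theorem GoodFrom.update {h h' : ℕ} {D : Data A d} (hD : m.GoodFrom h' D) {j b : ℕ} (hj : j ≤ b) :
    m.Update h h' D D j b :=
  ⟨fun _ _ => SameLevel.refl _ _, hD, le_rfl, Nat.add_le_add_right hj _⟩

namespace Update

variable {h h' k k' j b i e : ℕ} {D D' D'' : Data A d}

theorem trans (hkh : h ≤ k) (hD : m.Update k k' D D' i e) (hD' : m.Update h h' D' D'' j b) :
    m.Update h h' D D'' (i + j) (e + b) where
  sameLevel q hq := (hD.sameLevel q (hq.trans_le hkh)).trans (hD'.sameLevel q hq)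
  goodFrom := hD'.goodFrom
  size_le := hD.size_le.trans hD'.size_le
  cost_le := by linarith [hD.cost_le, hD'.cost_le]

theorem mono (hD : m.Update h h' D D' j b) (hcost : i + b ≤ j + e) : m.Update h h' D D' i e :=
  { hD with cost_le := by linarith [hD.cost_le] }

/-- The levels between `h` and `k` are unchanged, so they remain good. -/
theorem lower (hD : m.Update k k D D' j b) (hkh : h ≤ k) (hgood : m.GoodFrom h D) :
    m.Update h h D D' j b :=
  { hD with
    sameLevel := fun q hq => hD.sameLevel q (hq.trans_le hkh)
    goodFrom := hgood.of_sameLevel hD.goodFrom hD.sameLevel }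

end Update

theorem GoodFrom.update_addPair {h : ℕ} {D : Data A d} (hD : m.GoodFrom (h + 1) D) (a : A)
    (x : EuclideanSpace ℝ (Fin d)) (y : ℝ) : m.Update h (h + 1) D (D.addPair a h x y) 0 0 where
  sameLevel _ hk := sameLevel_addPair D a hk.ne x y
  goodFrom k hk := (hD k hk).of_sameLevel (sameLevel_addPair D a (Nat.lt_of_succ_le hk).ne' x y)
  size_le := le_rfl
  cost_le := le_rfl

theorem GoodLevel.addFeat {D D' : Data A d} {h : ℕ} (hD : m.GoodLevel D h)
    {x : EuclideanSpace ℝ (Fin d)} (hx : ‖x‖ ≤ 1) (hbad : c.ε < D.invNorm c.lam h x)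
    {as : List A} (has : ∀ a, a ∈ as) {y y' : A → ℝ} (hE : Explored h x as y D y' D')
    (hy : ∀ a, |y' a - inner ℝ (m.θ a h) x| ≤ m.targetError) :
    m.GoodLevel (D'.addFeat h x) h := by
  have hfeats : (D'.addFeat h x).feats h = D.feats h ++ [x] := by
    rw [feats_addFeat_self, hE.feats_eq]
  have hpairs : ∀ a, (D'.addFeat h x).pairs a h = D.pairs a h ++ [(x, y' a)] := fun a =>
    hE.pairs_of_mem a (has a)
  constructor
  · rw [hfeats, List.forall_mem_append, List.forall_mem_singleton]
    exact ⟨hD.norm_le_one, hx⟩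
  · rw [hfeats, List.length_append, List.length_singleton, pow_succ', mul_assoc]
    refine le_trans ?_ (two_mul_det_ridge_le m.lam_pos (m.eps_eq ▸ hbad))
    exact mul_le_mul_of_nonneg_left hD.le_det zero_le_two
  · intro a
    rw [hpairs, hfeats, List.map_append, hD.pairs_fst, List.map_singleton]
  · intro a
    rw [hpairs, List.forall_mem_append, List.forall_mem_singleton]
    exact ⟨hD.pairs_error a, hy a⟩

theorem GoodLevel.length_feats_le {D : Data A d} {h : ℕ} (hD : m.GoodLevel D h) :
    (D.feats h).length ≤ m.n₀ :=
  m.card_le _ (hD.le_det.trans (by simpa using det_ridge_le m.lam_pos hD.norm_le_one))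

theorem GoodFrom.size_le {D : Data A d} (hD : m.GoodFrom 0 D) : D.size c.H ≤ c.H * m.n₀ :=
  (Finset.sum_le_card_nsmul _ _ _ fun h _ => (hD h h.zero_le).length_feats_le).trans_eq (by simp)

theorem GoodLevel.abs_thetaHat_sub_Q_lt {l : List A} (hl : l.length < c.H) {D : Data A d}
    (hD : m.GoodLevel D l.length) {x : EuclideanSpace ℝ (Fin d)} (hx : m.AccurateFeature l x)
    (hn : D.invNorm c.lam l.length x ≤ c.ε) (a : A) :
    |D.thetaHat c.lam a l.length ⬝ᵥ x.ofLp - m.Q l a| < m.Δ / 2 := by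
  have hleverage :
      x.ofLp ⬝ᵥ ((ridge c.lam ((D.pairs a l.length).map Prod.fst))⁻¹ *ᵥ x.ofLp) ≤ 1 := by
    rw [m.eps_eq, Data.invNorm, Real.sqrt_le_one, Data.Sig_eq_ridge] at hn
    rwa [hD.pairs_fst]
  have hridge := abs_ridge_error_le m.lam_pos m.targetError_nonneg (D.pairs a l.length)
    (m.θ a l.length) (fun z hz => real_inner_eq_dotProduct _ z.1 ▸ hD.pairs_error a z hz) hleverage
  rw [← List.length_map Prod.fst, hD.pairs_fst, ← real_inner_eq_dotProduct (m.θ a _)] at hridge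
  calc |D.thetaHat c.lam a l.length ⬝ᵥ x.ofLp - m.Q l a|
      ≤ |D.thetaHat c.lam a l.length ⬝ᵥ x.ofLp - inner ℝ (m.θ a l.length) x|
        + |inner ℝ (m.θ a l.length) x - m.Q l a| := abs_sub_le _ _ _
    _ ≤ m.targetError * √(D.feats l.length).length + √c.lam * ‖m.θ a l.length‖ + m.ef :=
        add_le_add hridge (hx.abs_inner_sub_le a)
    _ ≤ m.targetError * √m.n₀ + √c.lam * m.Θ + m.ef := by
        gcongr
        · exact m.targetError_nonneg
        · exact hD.length_feats_le
        · exact m.norm_le a _ hl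
    _ < m.Δ / 2 := by
        rw [add_comm (m.targetError * _)]
        exact m.accuracy

theorem Q_greedy {l : List A} (hl : l.length < c.H) {D : Data A d}
    (hD : m.GoodLevel D l.length) {x : EuclideanSpace ℝ (Fin d)} (hx : m.AccurateFeature l x)
    (hn : D.invNorm c.lam l.length x ≤ c.ε) : m.Q l (greedy c D l.length x) = m.V l := by
  have hpred := hD.abs_thetaHat_sub_Q_lt hl hx hn
  obtain ⟨b, -, hb⟩ := Finset.exists_mem_eq_sup' Finset.univ_nonempty (m.Q l)
  rw [← m.V_eq l hl] at hb
  have hgreedy : D.thetaHat c.lam b l.length ⬝ᵥ x.ofLp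
      ≤ D.thetaHat c.lam (greedy c D l.length x) l.length ⬝ᵥ x.ofLp :=
    m.argmax_le (fun a => D.thetaHat c.lam a l.length ⬝ᵥ x.ofLp) b
  have hle : m.Q l (greedy c D l.length x) ≤ m.V l := by
    rw [m.V_eq l hl]
    exact Finset.le_sup' (m.Q l) (Finset.mem_univ _)
  by_contra hne
  have hgap := m.gap l _ hl (sub_pos.2 (lt_of_le_of_ne hle hne))
  linarith [(abs_lt.1 (hpred b)).1, (abs_lt.1 (hpred (greedy c D l.length x))).2]

variable (m)

theorem rewardLoop_spec {l : List A} (hl : l.length < c.H) (as : List A) (y : A → ℝ) :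
    Ensures P c.M s (rewardLoop c l as y) fun y' j => j = as.length ∧
      (∀ b ∈ as, |y' b - m.r l b| ≤ m.er) ∧ ∀ b ∉ as, y' b = y b := by
  classical
  induction as generalizing y with
  | nil => exact Ensures.ret ⟨rfl, by simp, fun _ _ => rfl⟩
  | cons a as ih =>
    refine (m.reward l a hl).bind fun z j ⟨hj, hz⟩ => (ih _).mono fun y' k ⟨hk, hmem, hnotMem⟩ => ?_
    refine ⟨by rw [hj, hk, List.length_cons, add_comm], fun b hb => ?_, fun b hb => ?_⟩
    · by_cases hbs : b ∈ as
      · exact hmem b hbs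
      · obtain rfl : b = a := (List.mem_cons.1 hb).resolve_right hbs
        rwa [hnotMem b hbs, Function.update_self]
    · obtain ⟨hba, hbs⟩ := not_or.1 (List.mem_cons.not.1 hb)
      rw [hnotMem b hbs, Function.update_of_ne hba]

/-- The specification of `computeV` with `n` steps to go. -/
def ComputeSpec (n : ℕ) (f : List A → Data A d → Prog A O (ℝ × Data A d)) : Prop :=
  ∀ l D, l.length + n = c.H → m.GoodFrom l.length D →
    Ensures P c.M s (f l D) fun v j => |v.1 - m.V l| ≤ n * m.er ∧
      m.Update l.length l.length D v.2 j (2 * n + Fintype.card A)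

variable {m}

theorem exploreLoop_spec {n : ℕ} {f : List A → Data A d → Prog A O (ℝ × Data A d)}
    (hf : m.ComputeSpec n f) {l : List A} (hl : l.length + (n + 1) = c.H)
    (x : EuclideanSpace ℝ (Fin d)) (as : List A) (has : as.Nodup) (y : A → ℝ) (D : Data A d)
    (hD : m.GoodFrom (l.length + 1) D) :
    Ensures P c.M s (exploreLoop c f l x as y D) fun z j =>
      (∀ b ∈ as, |z.1 b - m.Q l b| ≤ (n + 1) * m.er) ∧
      Explored l.length x as y D z.1 z.2 ∧
      m.Update l.length (l.length + 1) D z.2 j (as.length * (1 + 2 * n + Fintype.card A)) := by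
  classical
  induction as generalizing y D with
  | nil => exact Ensures.ret ⟨by simp, Explored.nil _ x y D, hD.update (Nat.zero_le _)⟩
  | cons a as ih =>
    obtain ⟨ha, has⟩ := List.nodup_cons.1 has
    have hla : (l ++ [a]).length = l.length + 1 := List.length_append
    refine (m.reward l a (by omega)).bind fun ρ j ⟨_, hρ⟩ =>
      (hf (l ++ [a]) D (by omega) (hla ▸ hD)).bind fun v i ⟨hv, hupd⟩ => ?_
    rw [hla] at hupd
    have hadd := hupd.goodFrom.update_addPair a x (ρ + v.1)
    refine (ih has _ _ hadd.goodFrom).mono fun z k ⟨htargets, hexplored, hrest⟩ =>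
      ⟨fun b hb => ?_, hexplored.cons ha (hupd.sameLevel _ (Nat.lt_succ_self _)), ?_⟩
    · by_cases hbs : b ∈ as
      · exact htargets b hbs
      · obtain rfl : b = a := (List.mem_cons.1 hb).resolve_right hbs
        rw [hexplored.target_of_notMem b hbs, Function.update_self, m.Q_eq l b (by omega), add_mul,
          one_mul, add_comm (n * m.er)]
        exact abs_add_sub_add_le hρ hv
    · refine ((hupd.trans (Nat.le_succ _) hadd).trans le_rfl hrest).mono ?_
      rw [List.length_cons, add_mul]
      omega

theorem explore_spec {n : ℕ} {f : List A → Data A d → Prog A O (ℝ × Data A d)}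
    (hf : m.ComputeSpec n f) {l : List A} (hl : l.length + (n + 1) = c.H)
    {x : EuclideanSpace ℝ (Fin d)} (hx : m.AccurateFeature l x) {D : Data A d}
    (hbad : c.ε < D.invNorm c.lam l.length x) (hD : m.GoodFrom l.length D) :
    Ensures P c.M s (explore c f l x D) fun z j =>
      (∀ b, |z.1 b - m.Q l b| ≤ (n + 1) * m.er) ∧ D.size c.H + 1 ≤ z.2.size c.H ∧
      m.Update l.length l.length D z.2 j 0 := by
  refine (exploreLoop_spec hf hl x _ (Finset.nodup_toList _) _ D fun k hk => hD k (by omega)).bind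
    fun z j ⟨htargets, hexplored, hupd⟩ => Ensures.ret ?_
  have hmem : ∀ a, a ∈ (Finset.univ : Finset A).toList := fun a =>
    Finset.mem_toList.2 (Finset.mem_univ a)
  have hsize := Data.size_addFeat z.2 (by omega : l.length < c.H) x
  have htargets' : ∀ a, |z.1 a - inner ℝ (m.θ a l.length) x| ≤ m.targetError := fun a =>
    (abs_sub_le _ (m.Q l a) _).trans <| add_le_add
      ((htargets a (hmem a)).trans
        (mul_le_mul_of_nonneg_right (mod_cast (by omega : n + 1 ≤ c.H)) m.er_nonneg))
      (abs_sub_comm (m.Q l a) _ ▸ hx.abs_inner_sub_le a)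
  have hgood := (hD _ le_rfl).addFeat hx.norm_le_one hbad hmem hexplored htargets'
  refine ⟨fun a => htargets a (hmem a), ?_, fun k hk => ?_, fun k hk => ?_, ?_, ?_⟩
  · exact (Nat.add_le_add_right hupd.size_le 1).trans_eq hsize.symm
  · exact (hupd.sameLevel k hk).trans (sameLevel_addFeat _ hk.ne _)
  · rcases hk.eq_or_lt with rfl | hk
    · exact hgood
    · exact (hupd.goodFrom k hk).of_sameLevel (sameLevel_addFeat _ hk.ne' _)
  · exact hupd.size_le.trans (hsize ▸ Nat.le_succ _)
  · have hloop : (Finset.univ : Finset A).toList.length * (1 + 2 * n + Fintype.card A)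
        ≤ exploreCost (Fintype.card A) c.H := by
      rw [Finset.length_toList, Finset.card_univ, exploreCost]
      gcongr
      omega
    dsimp only
    rw [hsize, mul_add, mul_one]
    linarith [hupd.cost_le]

theorem computeV_one_spec : m.ComputeSpec 1 (computeV c 1) := by
  intro l D hl hD
  have hlH : l.length < c.H := by omega
  refine (m.rewardLoop_spec hlH _ _).bind fun y j ⟨hj, hy, _⟩ => Ensures.ret
    ⟨?_, hD.update ?_⟩
  · rw [m.V_eq l hlH]
    refine abs_sup'_sub_sup'_le _ fun a ha => ?_
    rw [m.Q_eq l a hlH, m.V_end _ (by simpa using hl)]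
    simpa using hy a (Finset.mem_toList.2 ha)
  · rw [hj, Finset.length_toList, Finset.card_univ]
    omega

theorem followGreedy_spec {n : ℕ} {f : List A → Data A d → Prog A O (ℝ × Data A d)}
    (hf : m.ComputeSpec n f) {l : List A} (hl : l.length + (n + 1) = c.H) {D : Data A d}
    (hD : m.GoodFrom l.length D) {a : A} (ha : m.Q l a = m.V l) :
    Ensures P c.M s ((estReward c l a).bind fun r => (f (l ++ [a]) D).bind fun v =>
      Prog.ret (r + v.1, v.2)) fun v j => |v.1 - m.V l| ≤ (n + 1) * m.er ∧
        m.Update l.length l.length D v.2 j (2 * n + Fintype.card A + 1) := by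
  have hla : (l ++ [a]).length = l.length + 1 := List.length_append
  refine (m.reward l a (by omega)).bind fun ρ j ⟨_, hρ⟩ =>
    (hf (l ++ [a]) D (by omega) fun k hk => hD k (by omega)).bind fun v i ⟨hv, hupd⟩ =>
      Ensures.ret ⟨?_, ?_⟩
  · rw [← ha, m.Q_eq l a (by omega), add_mul, one_mul, add_comm (n * m.er)]
    exact abs_add_sub_add_le hρ hv
  · exact (hupd.lower (by omega) hD).mono (by omega)

theorem computeV_spec (n : ℕ) : m.ComputeSpec n (computeV c n) := by
  induction n with
  | zero => exact fun l D hl hD => Ensures.ret ⟨by simp [m.V_end l hl], hD.update (Nat.zero_le _)⟩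
  | succ n ih =>
    cases n with
    | zero => exact computeV_one_spec
    | succ n =>
      intro l D hl hD
      have hlH : l.length < c.H := by omega
      refine (m.ensures_accurateFeature hlH).bind fun x j ⟨_, hx⟩ => ?_
      split_ifs with hgood
      · refine (followGreedy_spec ih hl hD (Q_greedy hlH (hD _ le_rfl) hx hgood)).mono
          fun v i ⟨hv, hupd⟩ => ⟨mod_cast hv, hupd.mono (by omega)⟩
      · refine (explore_spec ih hl hx (not_le.1 hgood) hD).bind
          fun z i ⟨htargets, _, hupd⟩ => Ensures.ret ⟨?_, hupd.mono (by omega)⟩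
        rw [m.V_eq l hlH]
        exact abs_sup'_sub_sup'_le _ fun a _ => mod_cast htargets a

theorem rollout_spec {D : Data A d} (hD : m.GoodFrom 0 D) (n : ℕ) (l : List A)
    (hl : l.length + n = c.H) :
    Ensures P c.M s (rollout c D n l) fun z j => j = n ∧
      (∀ q ∈ z.2, q.1.length < c.H ∧ m.AccurateFeature q.1 q.2) ∧
      ((∀ q ∈ z.2, D.invNorm c.lam q.1.length q.2 ≤ c.ε) →
        ∃ t, z.1 = l ++ t ∧ t.length = n ∧ pathReward m.r l t = m.V l) := by
  induction n generalizing l with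
  | zero =>
    exact Ensures.ret ⟨rfl, by simp, fun _ => ⟨[], by simp, rfl, (m.V_end l hl).symm⟩⟩
  | succ n ih =>
    have hlH : l.length < c.H := by omega
    refine (m.ensures_accurateFeature hlH).bind fun x j ⟨_, hx⟩ =>
      (ih (l ++ [greedy c D l.length x]) (by simp; omega)).bind
        fun z i ⟨_, hacc, hopt⟩ => Ensures.ret ⟨by omega, ?_, fun hq => ?_⟩
    · rw [List.forall_mem_cons]
      exact ⟨⟨hlH, hx⟩, hacc⟩
    · obtain ⟨hql, hq⟩ := List.forall_mem_cons.1 hq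
      obtain ⟨t, hzt, ht, htV⟩ := hopt hq
      refine ⟨greedy c D l.length x :: t, by simpa using hzt, by simp [ht], ?_⟩
      rw [pathReward, htV, ← m.Q_eq l _ hlH, Q_greedy hlH (hD _ (Nat.zero_le _)) hx hql]

/-- Every iteration but the last one stores a feature, which can happen at most `H * n₀` times. -/
theorem mainLoop_spec (n : ℕ) {D : Data A d} (hD : m.GoodFrom 0 D)
    (hn : c.H * m.n₀ < D.size c.H + n) :
    Ensures P c.M s (mainLoop c n D) fun out j =>
      (∃ l, out = some l ∧ l.length = c.H ∧ pathReward m.r [] l = m.V []) ∧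
      j + (exploreCost (Fintype.card A) c.H + c.H) * D.size c.H
        ≤ estimateBound (Fintype.card A) c.H m.n₀ := by
  have hsize := hD.size_le
  induction n generalizing D with
  | zero => omega
  | succ n ih =>
    refine (rollout_spec hD c.H [] (by simp)).bind fun z j ⟨hj, hacc, hopt⟩ => ?_
    split
    · rename_i hfind
      obtain ⟨t, hzt, ht, htV⟩ := hopt fun q hq => by
        simpa using List.find?_eq_none.1 hfind q hq
      refine Ensures.ret ⟨⟨t, by rw [hzt, List.nil_append], ht, htV⟩, ?_⟩
      rw [hj, estimateBound]
      gcongr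
      exact le_rfl
    · rename_i q hfind
      obtain ⟨hqH, hq⟩ := hacc q (List.mem_of_find?_eq_some hfind)
      have hbad := List.find?_some hfind
      rw [decide_eq_true_eq] at hbad
      refine (explore_spec (computeV_spec _) (by omega) hq hbad fun k _ => hD k k.zero_le).bind
        fun w i ⟨_, hgrow, hupd⟩ => ?_
      have hD' : m.GoodFrom 0 w.2 := hD.of_sameLevel hupd.goodFrom hupd.sameLevel
      refine (ih hD' (by omega) hD'.size_le).mono fun out k ⟨hout, hcost⟩ => ⟨hout, ?_⟩
      have hrollout := Nat.mul_le_mul_left c.H hgrow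
      linarith [hcost, hupd.cost_le]

variable (m)

theorem le_successProb (hs : 1 ≤ s) {w : ℝ≥0∞}
    (hw : w * s ^ estimateBound (Fintype.card A) c.H m.n₀ ≤ 1) {E : List A → ℕ → Prop}
    (hE : ∀ l j, l.length = c.H → pathReward m.r [] l = m.V [] →
      j ≤ estimateBound (Fintype.card A) c.H m.n₀ → E l (c.H * (j * c.M))) :
    w ≤ successProb c P E := by
  refine le_trans ?_ (le_iSup _ (c.H * m.n₀ + 1))
  refine m.mainLoop_spec _ (fun k _ => goodLevel_empty k) (by omega) _ 0 w
    fun out j ⟨⟨l, hout, hl, hV⟩, hcost⟩ => ?_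
  have hj := le_of_add_le_left hcost
  rw [if_pos ⟨l, hout, by rw [zero_add]; exact hE l j hl hV hj⟩]
  exact le_trans (by gcongr) hw

end AccurateModel

end Analysis

/-! ## POMDPs with deterministic latent transitions -/

theorem pathReward_nonneg {A : Type*} {r : List A → A → ℝ} (hr : ∀ l a, 0 ≤ r l a) (l t : List A) :
    0 ≤ pathReward r l t := by
  induction t generalizing l with
  | nil => exact le_rfl
  | cons a t ih => exact add_nonneg (hr l a) (ih _)

/-- Unlike for `lintegral_dirac`, neither `f` nor the singleton `{x}` needs to be measurable. -/
theorem lintegral_dirac_le {α : Type*} [MeasurableSpace α] (x : α) (f : α → ℝ≥0∞) :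
    ∫⁻ y, f y ∂(Measure.dirac x) ≤ f x := by
  obtain ⟨g, hg, hgf, hfg⟩ := exists_measurable_le_lintegral_eq (Measure.dirac x) f
  rw [hfg, lintegral_dirac' x hg]
  exact hgf x

namespace POMDP

/-- The latent state that is reached from `s` at time `h` by a list of actions, when the transitions
are given by the map `p`. -/
def stateAt {S A : Type*} (p : ℕ → S → A → S) : ℕ → S → List A → S
  | _, s, [] => s
  | h, s, a :: l => stateAt p (h + 1) (p h s a) l

theorem stateAt_append_singleton {S A : Type*} (p : ℕ → S → A → S) (h : ℕ) (s : S) (l : List A)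
    (a : A) : stateAt p h s (l ++ [a]) = p (h + l.length) (stateAt p h s l) a := by
  induction l generalizing h s with
  | nil => rfl
  | cons b l ih =>
    rw [List.cons_append, stateAt, ih, stateAt, List.length_cons, Nat.add_right_comm, Nat.add_assoc]

variable {S A O : Type*} [MeasurableSpace S] [MeasurableSpace O]

instance isMarkovKernel_emit (P : POMDP S A O) (h : ℕ) : IsMarkovKernel (P.emit h) :=
  P.emit_markov h

instance isMarkovKernel_rew (P : POMDP S A O) (h : ℕ) (a : A) : IsMarkovKernel (P.rew h a) :=
  P.rew_markov h a

theorem meanReward_nonneg (P : POMDP S A O) (h : ℕ) (s : S) (a : A) : 0 ≤ P.meanReward h s a :=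
  integral_nonneg_of_ae ((P.rew_mem h a s).mono fun _ hy => hy.1)

theorem lintegral_rew (P : POMDP S A O) (h : ℕ) (s : S) (a : A) :
    ∫⁻ y, ENNReal.ofReal y ∂(P.rew h a s) = ENNReal.ofReal (P.meanReward h s a) :=
  (ofReal_integral_eq_lintegral_ofReal (.of_mem_Icc 0 1 aemeasurable_id (P.rew_mem h a s))
    ((P.rew_mem h a s).mono fun _ hy => hy.1)).symm

theorem lintegral_rew_add_const (P : POMDP S A O) (h : ℕ) (s : S) (a : A) (v : ℝ≥0∞) :
    ∫⁻ y, (ENNReal.ofReal y + v) ∂(P.rew h a s) = ENNReal.ofReal (P.meanReward h s a) + v := by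
  rw [lintegral_add_right _ measurable_const, lintegral_rew, lintegral_const, measure_univ, mul_one]

/-- The transitions before the horizon `H` are deterministic and given by the map `p`. -/
def IsDeterministic (P : POMDP S A O) (p : ℕ → S → A → S) (H : ℕ) : Prop :=
  ∀ h < H, ∀ s a, P.trans h a s = Measure.dirac (p h s a)

variable {P : POMDP S A O} {p : ℕ → S → A → S} {H : ℕ}

theorem stateLawFrom_dirac (hp : P.IsDeterministic p H) (h : ℕ) (s : S) (l : List A)
    (hl : h + l.length ≤ H) :
    P.stateLawFrom h (Measure.dirac s) l = Measure.dirac (stateAt p h s l) := by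
  induction l generalizing h s with
  | nil => rfl
  | cons a l ih =>
    rw [List.length_cons] at hl
    rw [stateLawFrom, Measure.dirac_bind (P.trans h a).measurable, hp h (by omega),
      ih _ _ (by omega), stateAt]

theorem obsLaw_eq (hp : P.IsDeterministic p H) {l : List A} (hl : l.length ≤ H) :
    P.obsLaw l = P.emit l.length (stateAt p 0 P.init l) := by
  rw [obsLaw, stateLaw, stateLawFrom_dirac hp _ _ _ (by omega),
    Measure.dirac_bind (P.emit _).measurable]

theorem rewLaw_eq (hp : P.IsDeterministic p H) {l : List A} (hl : l.length ≤ H) (a : A) :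
    P.rewLaw l a = P.rew l.length a (stateAt p 0 P.init l) := by
  rw [rewLaw, stateLaw, stateLawFrom_dirac hp _ _ _ (by omega),
    Measure.dirac_bind (P.rew _ _).measurable]

variable [Fintype A]

theorem policyValueFrom_succ_le (π : Policy A O) {n h : ℕ} {s : S} {hist : List (O × A × ℝ)}
    {v : ℝ≥0∞} (hv : ∀ o a, ∫⁻ y, (ENNReal.ofReal y + ∫⁻ s', P.policyValueFrom π n (h + 1) s'
      (hist ++ [(o, a, y)]) ∂(P.trans h a s)) ∂(P.rew h a s) ≤ v) :
    P.policyValueFrom π (n + 1) h s hist ≤ v := by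
  calc P.policyValueFrom π (n + 1) h s hist
      ≤ ∫⁻ o, ∑ a, π hist o a * v ∂(P.emit h s) := by
        refine lintegral_mono fun o => Finset.sum_le_sum fun a _ => ?_
        gcongr
        exact hv o a
    _ = ∫⁻ _, v ∂(P.emit h s) := by
        refine lintegral_congr fun o => ?_
        rw [← Finset.sum_mul, ← tsum_fintype (L := .unconditional A), PMF.tsum_coe, one_mul]
    _ = v := by rw [lintegral_const, measure_univ, mul_one]

variable [Nonempty A]

theorem Vstar_eq {h : ℕ} (hh : h < H) (s : S) :
    P.Vstar p H h s = P.valueToGo p (H - h) h s := by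
  obtain ⟨n, rfl⟩ := Nat.exists_eq_add_of_lt hh
  rw [Vstar, show h + n + 1 - h = n + 1 by omega, valueToGo]
  simp only [Qstar, hh, if_true, show h + n + 1 - (h + 1) = n by omega]

theorem le_valueToGo_succ (P : POMDP S A O) (p : ℕ → S → A → S) (n h : ℕ) (s : S) (a : A) :
    P.meanReward h s a + P.valueToGo p n (h + 1) (p h s a) ≤ P.valueToGo p (n + 1) h s :=
  Finset.le_sup' (fun a => P.meanReward h s a + P.valueToGo p n (h + 1) (p h s a))
    (Finset.mem_univ a)

theorem valueToGo_nonneg (P : POMDP S A O) (p : ℕ → S → A → S) (n h : ℕ) (s : S) :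
    0 ≤ P.valueToGo p n h s := by
  induction n generalizing h s with
  | zero => exact le_rfl
  | succ n ih =>
    exact (add_nonneg (P.meanReward_nonneg h s (Classical.arbitrary A)) (ih _ _)).trans
      (le_valueToGo_succ P p n h s _)

theorem policyValueFrom_le (hp : P.IsDeterministic p H) (π : Policy A O) (n h : ℕ)
    (hn : h + n ≤ H) (s : S) (hist : List (O × A × ℝ)) :
    P.policyValueFrom π n h s hist ≤ ENNReal.ofReal (P.valueToGo p n h s) := by
  induction n generalizing h s hist with
  | zero => exact bot_le
  | succ n ih =>
    refine policyValueFrom_succ_le π fun o a => ?_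
    calc ∫⁻ y, (ENNReal.ofReal y + ∫⁻ s', P.policyValueFrom π n (h + 1) s' (hist ++ [(o, a, y)])
            ∂(P.trans h a s)) ∂(P.rew h a s)
        ≤ ∫⁻ y, (ENNReal.ofReal y + ENNReal.ofReal (P.valueToGo p n (h + 1) (p h s a)))
            ∂(P.rew h a s) := by
          refine lintegral_mono fun y => add_le_add_right ?_ (ENNReal.ofReal y)
          rw [hp h (by omega)]
          exact (lintegral_dirac_le _ _).trans (ih _ (by omega) _ _)
      _ = ENNReal.ofReal (P.meanReward h s a + P.valueToGo p n (h + 1) (p h s a)) := by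
          rw [lintegral_rew_add_const,
            ENNReal.ofReal_add (P.meanReward_nonneg h s a) (P.valueToGo_nonneg p _ _ _)]
      _ ≤ ENNReal.ofReal (P.valueToGo p (n + 1) h s) :=
          ENNReal.ofReal_le_ofReal (le_valueToGo_succ P p n h s a)

/-- The action that the policy `openLoop l` plays at time `h`. -/
noncomputable def openLoopAction (l : List A) (h : ℕ) : A :=
  (l[h]?).getD (Classical.arbitrary A)

/-- The value of an open-loop policy depends on the history only through its length; `F` is this
value one step later. -/
theorem policyValueFrom_openLoop_succ (l : List A) (n : ℕ) {F : S → ℝ≥0∞} {h : ℕ}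
    (hF : ∀ s hist, hist.length = h + 1 → P.policyValueFrom (openLoop l) n (h + 1) s hist = F s)
    (s : S) {hist : List (O × A × ℝ)} (hh : hist.length = h) :
    P.policyValueFrom (openLoop l) (n + 1) h s hist
      = ENNReal.ofReal (P.meanReward h s (openLoopAction l h))
        + ∫⁻ s', F s' ∂(P.trans h (openLoopAction l h) s) := by
  classical
  have hnext (o : O) (a : A) (y : ℝ) (s' : S) :
      P.policyValueFrom (openLoop l) n (h + 1) s' (hist ++ [(o, a, y)]) = F s' :=
    hF s' _ (by rw [List.length_append, hh, List.length_singleton])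
  have hpolicy (o : O) (a : A) :
      openLoop (O := O) l hist o a = if a = openLoopAction l h then 1 else 0 := by
    rw [openLoop, PMF.pure_apply, hh, openLoopAction]
  simp only [policyValueFrom, hnext, hpolicy, ite_mul, one_mul, zero_mul, Finset.sum_ite_eq',
    Finset.mem_univ, if_true, lintegral_rew_add_const, lintegral_const, measure_univ, mul_one]

theorem exists_policyValueFrom_openLoop (P : POMDP S A O) (l : List A) (n h : ℕ) :
    ∃ F : S → ℝ≥0∞, Measurable F ∧ ∀ s hist, hist.length = h →
      P.policyValueFrom (openLoop l) n h s hist = F s := by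
  induction n generalizing h with
  | zero => exact ⟨0, measurable_const, fun _ _ _ => rfl⟩
  | succ n ih =>
    obtain ⟨F, hF, hval⟩ := ih (h + 1)
    refine ⟨_, ?_, fun s _ => policyValueFrom_openLoop_succ l n hval s⟩
    simp only [← lintegral_rew]
    exact (Measurable.lintegral_kernel ENNReal.measurable_ofReal).add
      (Measurable.lintegral_kernel hF)

theorem policyValueFrom_openLoop (hp : P.IsDeterministic p H) (l t : List A)
    (hl : l.length + t.length ≤ H) {hist : List (O × A × ℝ)} (hh : hist.length = l.length) :
    P.policyValueFrom (openLoop (l ++ t)) t.length l.length (stateAt p 0 P.init l) hist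
      = ENNReal.ofReal (pathReward
        (fun l a => P.meanReward l.length (stateAt p 0 P.init l) a) l t) := by
  induction t generalizing l hist with
  | nil => exact ENNReal.ofReal_zero.symm
  | cons a t ih =>
    rw [List.length_cons] at hl
    obtain ⟨o⟩ : Nonempty O := (P.emit 0 P.init).nonempty_of_neZero
    obtain ⟨F, hF, hval⟩ := exists_policyValueFrom_openLoop P (l ++ a :: t) t.length (l.length + 1)
    have haction : openLoopAction (l ++ a :: t) l.length = a := by simp [openLoopAction]
    have hnext : F (p l.length (stateAt p 0 P.init l) a) = ENNReal.ofReal (pathReward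
        (fun l a => P.meanReward l.length (stateAt p 0 P.init l) a) (l ++ [a]) t) := by
      have hhist : (hist ++ [(o, a, 0)]).length = (l ++ [a]).length := by simp [hh]
      rw [← ih (l ++ [a]) (by simp; omega) hhist, List.append_assoc, List.singleton_append,
        stateAt_append_singleton, zero_add, List.length_append, List.length_singleton,
        hval _ _ (by simp [hh])]
    rw [List.length_cons, policyValueFrom_openLoop_succ _ _ hval _ hh, haction,
      hp _ (by omega), lintegral_dirac' _ hF, hnext, pathReward, ENNReal.ofReal_add
        (P.meanReward_nonneg _ _ _) (pathReward_nonneg (fun _ _ => P.meanReward_nonneg _ _ _) _ _)]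

theorem isOptimalSeq_of_pathReward (hp : P.IsDeterministic p H) {l : List A} (hl : l.length = H)
    (hV : pathReward (fun l a => P.meanReward l.length (stateAt p 0 P.init l) a) [] l
      = P.valueToGo p H 0 P.init) : P.IsOptimalSeq H l := by
  refine ⟨hl, fun π => ?_⟩
  have hopenLoop := policyValueFrom_openLoop hp [] l (by simp [hl]) (hist := []) rfl
  rw [hV, List.nil_append, hl] at hopenLoop
  exact (policyValueFrom_le hp π H 0 (by omega) P.init []).trans hopenLoop.ge

end POMDP

/-! ## The choice of the parameters -/

theorem le_of_two_pow_mul_le {d n : ℕ} (hd : 0 < d) {lam : ℝ} (hlam : 0 < lam) (hlam1 : lam ≤ 1)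
    (h : 2 ^ n * lam ^ d ≤ (n + lam * d) ^ d) : (n : ℝ) ≤ 4 * (d * Real.log (4 * d / lam)) := by
  have hd0 : (0 : ℝ) < d := by exact_mod_cast hd
  have hlog : n * Real.log 2 + d * Real.log lam ≤ d * Real.log (n + lam * d) := by
    have hlog_le := Real.log_le_log (by positivity) h
    rwa [Real.log_mul (by positivity) (by positivity), Real.log_pow, Real.log_pow,
      Real.log_pow] at hlog_le
  have htangent : Real.log (n + lam * d) ≤ Real.log (4 * d) + ((n + lam * d) / (4 * d) - 1) := by
    rw [← sub_le_iff_le_add', ← Real.log_div (by positivity) (by positivity)]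
    exact Real.log_le_sub_one_of_pos (by positivity)
  have hslope : d * ((n + lam * d) / (4 * d) - 1) ≤ n / 4 := by
    rw [show d * ((n + lam * d) / (4 * d) - 1) = n / 4 - d * (1 - lam / 4) by field_simp; ring]
    have : 0 ≤ d * (1 - lam / 4) := mul_nonneg hd0.le (by linarith)
    linarith
  have hlog_two : (n : ℝ) / 2 ≤ n * Real.log 2 := by
    rw [div_eq_mul_inv]
    gcongr
    linarith [Real.log_two_gt_d9]
  have htangent_mul := mul_le_mul_of_nonneg_left htangent hd0.le
  rw [Real.log_div (by positivity) hlam.ne', mul_sub]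
  linarith [mul_add (d : ℝ) (Real.log (4 * d)) ((n + lam * d) / (4 * d) - 1)]

theorem estimateBound_le {A H n₀ : ℕ} (hA : 0 < A) (hH : 0 < H) (hn : 0 < n₀) :
    estimateBound A H n₀ ≤ 6 * (H ^ 2 * A ^ 2 * n₀) := by
  have hexplore : exploreCost A H ≤ 4 * (A ^ 2 * H) := by
    calc A * (1 + 2 * H + A) ≤ A * (A * H + 2 * (A * H) + A * H) := by
          gcongr
          · exact Nat.mul_pos hA hH
          · exact Nat.le_mul_of_pos_left _ hA
          · exact Nat.le_mul_of_pos_right _ hH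
      _ = 4 * (A ^ 2 * H) := by ring
  have hrollout : H ≤ A ^ 2 * H := Nat.le_mul_of_pos_left _ (by positivity)
  have hlast : H ≤ H ^ 2 * A ^ 2 * n₀ := by
    calc H ≤ H * (H * A ^ 2 * n₀) := Nat.le_mul_of_pos_right _ (by positivity)
      _ = H ^ 2 * A ^ 2 * n₀ := by ring
  calc estimateBound A H n₀ ≤ H ^ 2 * A ^ 2 * n₀ + (4 * (A ^ 2 * H) + A ^ 2 * H) * (H * n₀) := by
        unfold estimateBound
        gcongr
    _ = 6 * (H ^ 2 * A ^ 2 * n₀) := by ring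

theorem le_estimateBound (A H n₀ : ℕ) : H ≤ estimateBound A H n₀ := Nat.le_add_right _ _

theorem log_le_mul_log {x y : ℝ} (hx : 0 < x) {k : ℕ} (h : x ≤ y ^ k) :
    Real.log x ≤ k * Real.log y :=
  (Real.log_le_log hx h).trans_eq (Real.log_pow y k)

/-- The quantities on which the parameters of the algorithm may depend: the number `A` of actions,
the horizon `H`, the dimension `d` of the features, the bound `Θ` on the regression parameters, the
gap `Δ` and the failure probability `δ`. -/
structure Setting where
  A : ℕ
  H : ℕ
  d : ℕ
  Θ : ℝ
  Δ : ℝ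
  δ : ℝ
  A_pos : 0 < A
  H_pos : 0 < H
  d_pos : 0 < d
  one_le_Θ : 1 ≤ Θ
  Δ_pos : 0 < Δ
  Δ_le_Θ : Δ ≤ Θ
  δ_pos : 0 < δ
  δ_le_half : δ ≤ 1 / 2

namespace Setting

variable (σ : Setting)

/-- The regularization parameter `λ`, for which `√λ Θ = Δ / 8`. -/
noncomputable def lam : ℝ := (σ.Δ / (8 * σ.Θ)) ^ 2

/-- A bound, from the elliptical potential argument, on the number of features in a data set. -/
noncomputable def featBound : ℕ := ⌈4 * (σ.d * Real.log (4 * σ.d / σ.lam))⌉₊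

/-- The bound on the number of estimates of the algorithm. -/
noncomputable def estimates : ℕ := estimateBound σ.A σ.H σ.featBound

/-- The probability with which a single estimate may fail. -/
noncomputable def failure : ℝ := σ.δ / σ.estimates

/-- The exponent that is required in Hoeffding's inequality: each of at most `A` deviations, on both
sides, has probability at most `exp (-confidence)`. -/
noncomputable def confidence : ℝ := Real.log (2 * σ.A / σ.failure)

/-- The number `M` of episodes for an estimate. -/
noncomputable def episodes : ℕ :=
  ⌈512 * (σ.H ^ 2 + σ.Θ ^ 2) * σ.featBound * σ.confidence / σ.Δ ^ 2⌉₊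

/-- The accuracy of the estimated rewards. -/
noncomputable def rewardError : ℝ := σ.Δ / (16 * σ.H * √σ.featBound)

/-- The accuracy of the estimated features. -/
noncomputable def featureError : ℝ := σ.Δ / (16 * √σ.featBound)

/-- The argument of the logarithmic factor `L` in the sample bound. -/
noncomputable def scale : ℝ := 2 + σ.H + σ.d + σ.A + σ.Θ + 1 / σ.Δ + Real.log (1 / σ.δ)

theorem one_le_A : (1 : ℝ) ≤ σ.A := by exact_mod_cast σ.A_pos

theorem one_le_H : (1 : ℝ) ≤ σ.H := by exact_mod_cast σ.H_pos

theorem one_le_d : (1 : ℝ) ≤ σ.d := by exact_mod_cast σ.d_pos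

theorem Θ_pos : 0 < σ.Θ := one_pos.trans_le σ.one_le_Θ

theorem one_le_Θ_div_Δ : 1 ≤ σ.Θ / σ.Δ := (one_le_div σ.Δ_pos).2 σ.Δ_le_Θ

theorem half_le_log_inv_δ : 1 / 2 ≤ Real.log (1 / σ.δ) := by
  have hlog : Real.log 2 ≤ Real.log (1 / σ.δ) :=
    Real.log_le_log two_pos ((le_div_comm₀ two_pos σ.δ_pos).2 σ.δ_le_half)
  linarith [Real.log_two_gt_d9]

theorem lam_pos : 0 < σ.lam := pow_pos (div_pos σ.Δ_pos (mul_pos (by norm_num) σ.Θ_pos)) 2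

theorem lam_le_one : σ.lam ≤ 1 := by
  have := σ.Θ_pos
  refine pow_le_one₀ (div_nonneg σ.Δ_pos.le (by positivity)) ?_
  rw [div_le_one (by positivity)]
  linarith [σ.Δ_le_Θ]

theorem log_d_div_lam_pos : 0 < Real.log (4 * σ.d / σ.lam) := by
  refine Real.log_pos ((one_lt_div σ.lam_pos).2 ?_)
  linarith [σ.lam_le_one, σ.one_le_d]

theorem featBound_pos : 0 < σ.featBound :=
  Nat.ceil_pos.2 (mul_pos (by norm_num) (mul_pos (by exact_mod_cast σ.d_pos) σ.log_d_div_lam_pos))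

theorem one_le_featBound : (1 : ℝ) ≤ σ.featBound := by exact_mod_cast σ.featBound_pos

theorem le_featBound {n : ℕ} (h : 2 ^ n * σ.lam ^ σ.d ≤ (n + σ.lam * σ.d) ^ σ.d) :
    n ≤ σ.featBound :=
  Nat.cast_le.1 ((le_of_two_pow_mul_le σ.d_pos σ.lam_pos σ.lam_le_one h).trans (Nat.le_ceil _))

theorem one_le_estimates : (1 : ℝ) ≤ σ.estimates := by
  exact_mod_cast σ.H_pos.trans_le (le_estimateBound _ _ _)

theorem failure_pos : 0 < σ.failure := div_pos σ.δ_pos (one_pos.trans_le σ.one_le_estimates)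

theorem failure_le_half : σ.failure ≤ 1 / 2 :=
  (div_le_self σ.δ_pos.le σ.one_le_estimates).trans σ.δ_le_half

theorem confidence_pos : 0 < σ.confidence := by
  refine Real.log_pos ((one_lt_div σ.failure_pos).2 ?_)
  linarith [σ.one_le_A, σ.failure_le_half]

theorem exp_neg_confidence : 2 * σ.A * Real.exp (-σ.confidence) = σ.failure := by
  have := σ.one_le_A
  have := σ.failure_pos
  rw [confidence, Real.exp_neg, Real.exp_log (by positivity)]
  field_simp

theorem rewardError_pos : 0 < σ.rewardError := by
  have := σ.one_le_H
  have := σ.one_le_featBound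
  exact div_pos σ.Δ_pos (by positivity)

theorem featureError_pos : 0 < σ.featureError := by
  have := σ.one_le_featBound
  exact div_pos σ.Δ_pos (by positivity)

theorem error_lt :
    √σ.lam * σ.Θ + (σ.H * σ.rewardError + σ.featureError) * √σ.featBound + σ.featureError
      < σ.Δ / 2 := by
  have := σ.Θ_pos
  have := σ.one_le_H
  have := σ.Δ_pos
  have hsqrt : 1 ≤ √(σ.featBound : ℝ) := Real.one_le_sqrt.2 σ.one_le_featBound
  have hlam : √σ.lam * σ.Θ = σ.Δ / 8 := by
    rw [lam, Real.sqrt_sq (by positivity)]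
    field_simp
  have hregression :
      (σ.H * σ.rewardError + σ.featureError) * √σ.featBound = σ.Δ / 8 := by
    rw [rewardError, featureError]
    field_simp
    norm_num
  have hfeature : σ.featureError ≤ σ.Δ / 16 := by
    rw [featureError]
    gcongr
    linarith
  linarith

theorem episodes_pos : 0 < σ.episodes := by
  have := σ.Θ_pos
  have := σ.featBound_pos
  have := σ.confidence_pos
  have := σ.Δ_pos
  exact Nat.ceil_pos.2 (by positivity)

theorem confidence_le_reward : σ.confidence ≤ σ.episodes * (2 * σ.rewardError ^ 2) := by
  have := σ.one_le_H
  have := σ.one_le_featBound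
  have := σ.confidence_pos
  have := σ.Δ_pos
  calc σ.confidence
      = 128 * σ.H ^ 2 * σ.featBound * σ.confidence / σ.Δ ^ 2 * (2 * σ.rewardError ^ 2) := by
        rw [rewardError, div_pow, mul_pow, Real.sq_sqrt (by positivity)]
        field_simp
        norm_num
    _ ≤ σ.episodes * (2 * σ.rewardError ^ 2) := by
        gcongr
        refine le_trans ?_ (Nat.le_ceil _)
        gcongr
        · norm_num
        · exact le_add_of_nonneg_right (sq_nonneg _)

theorem confidence_le_feature :
    σ.confidence ≤ σ.episodes * (σ.featureError ^ 2 / (2 * σ.Θ ^ 2)) := by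
  have := σ.Θ_pos
  have := σ.one_le_featBound
  have := σ.confidence_pos
  have := σ.Δ_pos
  calc σ.confidence
      = 512 * σ.Θ ^ 2 * σ.featBound * σ.confidence / σ.Δ ^ 2
          * (σ.featureError ^ 2 / (2 * σ.Θ ^ 2)) := by
        rw [featureError, div_pow, mul_pow, Real.sq_sqrt (by positivity)]
        field_simp
        norm_num
    _ ≤ σ.episodes * (σ.featureError ^ 2 / (2 * σ.Θ ^ 2)) := by
        gcongr
        refine le_trans ?_ (Nat.le_ceil _)
        gcongr
        exact le_add_of_nonneg_left (sq_nonneg _)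

theorem reward_failure_le :
    2 * Real.exp (-(σ.episodes * (2 * σ.rewardError ^ 2))) ≤ σ.failure := by
  rw [← exp_neg_confidence]
  gcongr
  · exact le_mul_of_one_le_right two_pos.le σ.one_le_A
  · exact σ.confidence_le_reward

theorem feature_failure_le :
    2 * σ.A * Real.exp (-(σ.episodes * (σ.featureError ^ 2 / (2 * σ.Θ ^ 2)))) ≤ σ.failure := by
  rw [← exp_neg_confidence]
  gcongr
  exact σ.confidence_le_feature

/-- The factor by which an estimate may enlarge the probability still at stake: the reciprocal of
its success probability. -/
noncomputable def inflation : ℝ≥0∞ := (ENNReal.ofReal (1 - σ.failure))⁻¹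

theorem one_le_inflation : 1 ≤ σ.inflation := by
  rw [inflation, ENNReal.one_le_inv]
  exact ENNReal.ofReal_le_one.2 (by linarith [σ.failure_pos])

theorem ofReal_mul_inflation : ENNReal.ofReal (1 - σ.failure) * σ.inflation = 1 :=
  ENNReal.mul_inv_cancel (ENNReal.ofReal_pos.2 (by linarith [σ.failure_le_half])).ne'
    ENNReal.ofReal_ne_top

theorem one_le_inflation_mul {x : ℝ} (hx : x ≤ σ.failure) :
    1 ≤ σ.inflation * (1 - ENNReal.ofReal x) := by
  calc 1 = σ.inflation * (1 - ENNReal.ofReal σ.failure) := by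
        rw [← ENNReal.ofReal_one, ← ENNReal.ofReal_sub _ σ.failure_pos.le, mul_comm,
          ofReal_mul_inflation, ENNReal.ofReal_one]
    _ ≤ σ.inflation * (1 - ENNReal.ofReal x) := by gcongr

theorem ofReal_mul_inflation_pow_le :
    ENNReal.ofReal (1 - σ.δ) * σ.inflation ^ σ.estimates ≤ 1 := by
  have hfailure : σ.estimates * σ.failure = σ.δ :=
    mul_div_cancel₀ _ (one_pos.trans_le σ.one_le_estimates).ne'
  have hpow : 1 - σ.δ ≤ (1 - σ.failure) ^ σ.estimates := by
    have hbernoulli := one_add_mul_le_pow (a := -σ.failure)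
      (by linarith [σ.failure_le_half]) σ.estimates
    rwa [mul_neg, hfailure, ← sub_eq_add_neg, ← sub_eq_add_neg] at hbernoulli
  calc ENNReal.ofReal (1 - σ.δ) * σ.inflation ^ σ.estimates
      ≤ ENNReal.ofReal (1 - σ.failure) ^ σ.estimates * σ.inflation ^ σ.estimates := by
        gcongr
        rw [← ENNReal.ofReal_pow (by linarith [σ.failure_le_half])]
        exact ENNReal.ofReal_le_ofReal hpow
    _ = 1 := by rw [← mul_pow, ofReal_mul_inflation, one_pow]

theorem le_scale :
    6 ≤ σ.scale ∧ σ.H ≤ σ.scale ∧ σ.d ≤ σ.scale ∧ σ.A ≤ σ.scale ∧ σ.Θ ≤ σ.scale ∧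
      1 / σ.Δ ≤ σ.scale := by
  have hΔ : 0 < 1 / σ.Δ := one_div_pos.2 σ.Δ_pos
  have := σ.one_le_H
  have := σ.one_le_d
  have := σ.one_le_A
  have := σ.one_le_Θ
  have := σ.half_le_log_inv_δ
  unfold scale
  refine ⟨?_, ?_, ?_, ?_, ?_, ?_⟩ <;> linarith

theorem one_le_log_scale : 1 ≤ Real.log σ.scale := by
  have hscale := σ.le_scale.1
  rw [Real.le_log_iff_exp_le (by linarith)]
  linarith [Real.exp_one_lt_d9]

theorem log_d_div_lam_le : Real.log (4 * σ.d / σ.lam) ≤ 9 * Real.log σ.scale := by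
  obtain ⟨hscale, -, hd, -, hΘ, hΔ⟩ := σ.le_scale
  have := σ.one_le_d
  have := σ.lam_pos
  have := σ.Θ_pos
  have := σ.Δ_pos
  refine log_le_mul_log (k := 9) (by positivity) ?_
  calc 4 * σ.d / σ.lam = 256 * σ.d * σ.Θ ^ 2 * (1 / σ.Δ) ^ 2 := by
        rw [lam]
        field_simp
        norm_num
    _ ≤ σ.scale ^ 4 * σ.scale * σ.scale ^ 2 * σ.scale ^ 2 := by
        gcongr
        calc (256 : ℝ) ≤ 6 ^ 4 := by norm_num
          _ ≤ σ.scale ^ 4 := by gcongr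
    _ = σ.scale ^ 9 := by ring

theorem featBound_le : (σ.featBound : ℝ) ≤ 37 * (σ.d * Real.log σ.scale) := by
  have hceil : (σ.featBound : ℝ) ≤ 4 * (σ.d * Real.log (4 * σ.d / σ.lam)) + 1 :=
    (Nat.ceil_lt_add_one (mul_nonneg (by norm_num)
      (mul_nonneg σ.d.cast_nonneg σ.log_d_div_lam_pos.le))).le
  have hlog := mul_le_mul_of_nonneg_left σ.log_d_div_lam_le σ.d.cast_nonneg
  linarith [one_le_mul_of_one_le_of_one_le σ.one_le_d σ.one_le_log_scale]

theorem estimates_le : (σ.estimates : ℝ) ≤ 6 * (σ.H ^ 2 * σ.A ^ 2 * σ.featBound) := by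
  exact_mod_cast estimateBound_le σ.A_pos σ.H_pos σ.featBound_pos

theorem confidence_le : σ.confidence ≤ 23 * (Real.log σ.scale * Real.log (1 / σ.δ)) := by
  obtain ⟨hscale, hH, hd, hA, -, -⟩ := σ.le_scale
  have hA1 := σ.one_le_A
  have hK1 := σ.one_le_estimates
  have hL1 := σ.one_le_log_scale
  have hℓ := σ.half_le_log_inv_δ
  have hδ := σ.δ_pos
  have hsplit : σ.confidence = Real.log (2 * σ.A * σ.estimates) + Real.log (1 / σ.δ) := by
    rw [confidence, failure, ← Real.log_mul (by positivity) (by positivity)]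
    congr 1
    field_simp
  have hlog : Real.log (2 * σ.A * σ.estimates) ≤ 11 * Real.log σ.scale := by
    refine log_le_mul_log (k := 11) (by positivity) ?_
    calc 2 * σ.A * σ.estimates
        ≤ 2 * σ.A * (6 * (σ.H ^ 2 * σ.A ^ 2 * (37 * (σ.d * Real.log σ.scale)))) := by
          gcongr
          exact σ.estimates_le.trans (by gcongr; exact σ.featBound_le)
      _ = 444 * σ.A ^ 3 * σ.H ^ 2 * σ.d * Real.log σ.scale := by ring
      _ ≤ σ.scale ^ 4 * σ.scale ^ 3 * σ.scale ^ 2 * σ.scale * σ.scale := by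
          gcongr
          · calc (444 : ℝ) ≤ 6 ^ 4 := by norm_num
              _ ≤ σ.scale ^ 4 := by gcongr
          · exact Real.log_le_self (by linarith)
      _ = σ.scale ^ 11 := by ring
  have hlog_le : Real.log σ.scale * (1 / 2) ≤ Real.log σ.scale * Real.log (1 / σ.δ) := by gcongr
  have hδ_le : Real.log (1 / σ.δ) ≤ Real.log σ.scale * Real.log (1 / σ.δ) :=
    le_mul_of_one_le_left (by linarith) hL1
  linarith

theorem episodes_le :
    (σ.episodes : ℝ) ≤ 23554 * ((σ.H * (σ.Θ / σ.Δ)) ^ 2 * σ.featBound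
      * (Real.log σ.scale * Real.log (1 / σ.δ))) := by
  have hL1 := σ.one_le_log_scale
  have hℓ := σ.half_le_log_inv_δ
  have hH1 := σ.one_le_H
  have hΘ1 := σ.one_le_Θ
  have hΔ := σ.Δ_pos
  have hR1 := σ.one_le_Θ_div_Δ
  have hn1 := σ.one_le_featBound
  have hΛ := σ.confidence_pos
  have hsq : (σ.H : ℝ) ^ 2 + σ.Θ ^ 2 ≤ 2 * (σ.H ^ 2 * σ.Θ ^ 2) := by
    linarith [le_mul_of_one_le_right (sq_nonneg (σ.H : ℝ)) (one_le_pow₀ hΘ1 (n := 2)),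
      le_mul_of_one_le_left (sq_nonneg σ.Θ) (one_le_pow₀ hH1 (n := 2))]
  have hmain : 512 * (σ.H ^ 2 + σ.Θ ^ 2) * σ.featBound * σ.confidence / σ.Δ ^ 2
      ≤ 23552 * ((σ.H * (σ.Θ / σ.Δ)) ^ 2 * σ.featBound
        * (Real.log σ.scale * Real.log (1 / σ.δ))) := by
    calc _ ≤ 512 * (2 * (σ.H ^ 2 * σ.Θ ^ 2)) * σ.featBound
            * (23 * (Real.log σ.scale * Real.log (1 / σ.δ))) / σ.Δ ^ 2 := by
          gcongr
          exact σ.confidence_le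
      _ = _ := by
          field_simp
          norm_num
  have hone : 1 * (1 / 2) ≤ (σ.H * (σ.Θ / σ.Δ)) ^ 2 * σ.featBound
      * (Real.log σ.scale * Real.log (1 / σ.δ)) := by
    gcongr
    · exact one_le_mul_of_one_le_of_one_le
        (one_le_pow₀ (one_le_mul_of_one_le_of_one_le hH1 hR1)) hn1
    · exact hℓ.trans (le_mul_of_one_le_left (by linarith) hL1)
  have hceil : (σ.episodes : ℝ) ≤ _ + 1 := (Nat.ceil_lt_add_one (by positivity)).le
  linarith

theorem samples_le :
    (σ.H : ℝ) * (σ.estimates * σ.episodes) ≤ 10 ^ 9 * Real.log σ.scale ^ 3 *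
      (σ.H ^ 5 * (σ.Θ / σ.Δ) ^ 2 * σ.d ^ 2 * σ.A ^ 2 * Real.log (1 / σ.δ)) := by
  have hL1 := σ.one_le_log_scale
  have hℓ := σ.half_le_log_inv_δ
  set L := Real.log σ.scale
  set ℓ := Real.log (1 / σ.δ)
  calc (σ.H : ℝ) * (σ.estimates * σ.episodes)
      ≤ σ.H * (6 * (σ.H ^ 2 * σ.A ^ 2 * σ.featBound)
          * (23554 * ((σ.H * (σ.Θ / σ.Δ)) ^ 2 * σ.featBound * (L * ℓ)))) := by
        gcongr
        · exact σ.estimates_le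
        · exact σ.episodes_le
    _ = 141324 * (σ.H ^ 5 * σ.A ^ 2 * (σ.Θ / σ.Δ) ^ 2 * L * ℓ) * σ.featBound ^ 2 := by ring
    _ ≤ 141324 * (σ.H ^ 5 * σ.A ^ 2 * (σ.Θ / σ.Δ) ^ 2 * L * ℓ) * (37 * (σ.d * L)) ^ 2 := by
        gcongr
        exact σ.featBound_le
    _ = 193472556 * L ^ 3 * (σ.H ^ 5 * (σ.Θ / σ.Δ) ^ 2 * σ.d ^ 2 * σ.A ^ 2 * ℓ) := by ring
    _ ≤ 10 ^ 9 * L ^ 3 * (σ.H ^ 5 * (σ.Θ / σ.Δ) ^ 2 * σ.d ^ 2 * σ.A ^ 2 * ℓ) := by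
        gcongr
        norm_num

theorem ratio_sq_bound_le :
    10 ^ 9 * Real.log σ.scale ^ 3 *
        (σ.H ^ 5 * (σ.Θ / σ.Δ) ^ 2 * σ.d ^ 2 * σ.A ^ 2 * Real.log (1 / σ.δ)) ≤
      10 ^ 9 * Real.log σ.scale ^ 3 *
        ((σ.H : ℝ) ^ 5 * σ.Θ ^ 5 * (σ.d : ℝ) ^ 2 * (σ.A : ℝ) ^ 2 * (1 / σ.Δ) ^ 5 *
          Real.log (1 / σ.δ)) := by
  have hL1 := σ.one_le_log_scale
  have hℓ := σ.half_le_log_inv_δ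
  have hratio : (σ.Θ / σ.Δ) ^ 2 ≤ σ.Θ ^ 5 * (1 / σ.Δ) ^ 5 := by
    rw [← mul_pow, mul_one_div]
    exact pow_le_pow_right₀ σ.one_le_Θ_div_Δ (by norm_num)
  calc _ ≤ 10 ^ 9 * Real.log σ.scale ^ 3 * (σ.H ^ 5 * (σ.Θ ^ 5 * (1 / σ.Δ) ^ 5) * σ.d ^ 2 *
        σ.A ^ 2 * Real.log (1 / σ.δ)) := by gcongr
    _ = _ := by ring

end Setting

/-! ## Accuracy of the estimates -/

theorem successProb_mono {S A O : Type*} [MeasurableSpace S] [MeasurableSpace O] [Fintype A]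
    [Nonempty A] {d : ℕ} {P : POMDP S A O} {c : Params A O d} {E F : List A → ℕ → Prop}
    (hEF : ∀ l N, E l N → F l N) : successProb c P E ≤ successProb c P F :=
  iSup_mono fun _ => Prog.prob_mono (fun _ _ ⟨l, hl, hE⟩ => ⟨l, hl, hEF _ _ hE⟩) _

section Model

variable {S A O : Type*} [MeasurableSpace S] [MeasurableSpace O] {d : ℕ} {P : POMDP S A O}
  {p : ℕ → S → A → S} {c : Params A O d} {s : ℝ≥0∞}

theorem ensures_estReward_meanReward (hp : P.IsDeterministic p c.H) {l : List A}
    (hl : l.length < c.H) (a : A) (hM : 0 < c.M) {e : ℝ} (he : 0 ≤ e)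
    (hs : 1 ≤ s * (1 - ENNReal.ofReal (2 * Real.exp (-(c.M * (2 * e ^ 2)))))) :
    Ensures P c.M s (estReward c l a) fun y j =>
      j = 1 ∧ |y - P.meanReward l.length (POMDP.stateAt p 0 P.init l) a| ≤ e := by
  have hlaw := POMDP.rewLaw_eq hp hl.le a
  have : IsProbabilityMeasure (P.rewLaw l a) := hlaw ▸ inferInstance
  rw [POMDP.meanReward, ← hlaw]
  exact ensures_estReward P c l a (hlaw ▸ P.rew_mem _ _ _) hM he hs

theorem ensures_estFeature_Qstar [Fintype A] [Nonempty A] (hp : P.IsDeterministic p c.H)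
    (hψ : Measurable c.ψ) (hψ1 : ∀ o, ‖c.ψ o‖ ≤ 1) {θ : A → ℕ → EuclideanSpace ℝ (Fin d)}
    {Θ : ℝ} (hΘ : 0 < Θ)
    (hθ : ∀ h < c.H, ∀ a, ‖θ a h‖ ≤ Θ)
    (hQ : ∀ h < c.H, ∀ s a, P.Qstar p c.H h s a = inner ℝ (θ a h) (∫ o, c.ψ o ∂(P.emit h s)))
    {l : List A} (hl : l.length < c.H) (hM : 0 < c.M) {e : ℝ} (he : 0 ≤ e)
    (hs : 1 ≤ s * (1 - ENNReal.ofReal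
      (2 * Fintype.card A * Real.exp (-(c.M * (e ^ 2 / (2 * Θ ^ 2))))))) :
    Ensures P c.M s (estFeature c l) fun x j => j = 1 ∧ ‖x‖ ≤ 1 ∧ ∀ a,
      |inner ℝ (θ a l.length) x - P.Qstar p c.H l.length (POMDP.stateAt p 0 P.init l) a| ≤ e := by
  have hlaw := POMDP.obsLaw_eq hp hl.le
  have : IsProbabilityMeasure (P.obsLaw l) := hlaw ▸ inferInstance
  have hintegral : Integrable c.ψ (P.obsLaw l) :=
    .of_bound hψ.aestronglyMeasurable 1 (Filter.Eventually.of_forall hψ1)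
  refine (ensures_estFeature P c l hψ hψ1 hM hΘ he (fun a => hθ _ hl a) hs).mono
    fun x j ⟨hj, hx, herr⟩ => ⟨hj, hx, fun a => ?_⟩
  rw [hQ _ hl, ← hlaw, ← integral_inner hintegral]
  exact herr a

end Model

namespace Setting

variable {S A O : Type*} [MeasurableSpace S] [MeasurableSpace O] (σ : Setting)

/-- The inputs of the algorithm.  The threshold for bad events is `ε = 1`, so that each of them at
least doubles the determinant of `Σ_h`. -/
noncomputable def params (ψ : O → EuclideanSpace ℝ (Fin σ.d)) (argmax : (A → ℝ) → A) :
    Params A O σ.d :=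
  ⟨σ.H, ψ, σ.episodes, 1, σ.lam, argmax⟩

variable [Fintype A] [Nonempty A]

/-- The analysis applies to a POMDP with deterministic transitions whose optimal `Q`-function is
linear in the mean embedding of the observations. -/
noncomputable def accurateModel (hA : Fintype.card A = σ.A) {P : POMDP S A O} {p : ℕ → S → A → S}
    {ψ : O → EuclideanSpace ℝ (Fin σ.d)} {θ : A → ℕ → EuclideanSpace ℝ (Fin σ.d)}
    {argmax : (A → ℝ) → A} (hψ : Measurable ψ) (hψ1 : ∀ o, ‖ψ o‖ ≤ 1)
    (hp : P.IsDeterministic p σ.H)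
    (hQ : ∀ h < σ.H, ∀ s a, P.Qstar p σ.H h s a = inner ℝ (θ a h) (∫ o, ψ o ∂(P.emit h s)))
    (hθ : ∀ h < σ.H, ∀ a, ‖θ a h‖ ≤ σ.Θ)
    (hgap : ∀ h < σ.H, ∀ s a, 0 < P.gap p σ.H h s a → σ.Δ ≤ P.gap p σ.H h s a)
    (hargmax : ∀ (f : A → ℝ) (a : A), f a ≤ f (argmax f)) :
    AccurateModel P (σ.params ψ argmax) σ.inflation where
  V l := P.valueToGo p (σ.H - l.length) l.length (POMDP.stateAt p 0 P.init l)
  Q l a := P.Qstar p σ.H l.length (POMDP.stateAt p 0 P.init l) a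
  r l a := P.meanReward l.length (POMDP.stateAt p 0 P.init l) a
  θ := θ
  Θ := σ.Θ
  Δ := σ.Δ
  er := σ.rewardError
  ef := σ.featureError
  n₀ := σ.featBound
  lam_pos := σ.lam_pos
  eps_eq := rfl
  er_nonneg := σ.rewardError_pos.le
  ef_nonneg := σ.featureError_pos.le
  argmax_le := hargmax
  reward l a hl := ensures_estReward_meanReward hp hl a σ.episodes_pos σ.rewardError_pos.le
    (σ.one_le_inflation_mul σ.reward_failure_le)
  feature l hl := ensures_estFeature_Qstar (c := σ.params ψ argmax) hp hψ hψ1 σ.Θ_pos hθ hQ hl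
    σ.episodes_pos σ.featureError_pos.le (σ.one_le_inflation_mul (hA ▸ σ.feature_failure_le))
  Q_eq l a (hl : l.length < σ.H) := by
    rw [POMDP.Qstar, if_pos hl, POMDP.stateAt_append_singleton, zero_add, List.length_append,
      List.length_singleton]
  V_eq l (hl : l.length < σ.H) := (POMDP.Vstar_eq hl _).symm
  V_end l hl := by rw [hl, show σ.H - (σ.params ψ argmax).H = 0 from Nat.sub_self _]; rfl
  gap l a (hl : l.length < σ.H) := by
    rw [← POMDP.Vstar_eq hl]
    exact hgap _ hl _ _
  norm_le a h hh := hθ h hh a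
  card_le _ := σ.le_featBound
  accuracy := σ.error_lt

end Setting

end EQDP

theorem mainTheorem1_general {S A O : Type*} [MeasurableSpace S] [MeasurableSpace O] [Fintype A]
    [Nonempty A] (σ : EQDP.Setting) (hA : Fintype.card A = σ.A) {P : EQDP.POMDP S A O}
    {p : ℕ → S → A → S} {ψ : O → EuclideanSpace ℝ (Fin σ.d)}
    {θ : A → ℕ → EuclideanSpace ℝ (Fin σ.d)} {argmax : (A → ℝ) → A} (hψ : Measurable ψ)
    (hψ1 : ∀ o, ‖ψ o‖ ≤ 1)
    (hp : P.IsDeterministic p σ.H)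
    (hQ : ∀ h < σ.H, ∀ s a, P.Qstar p σ.H h s a = inner ℝ (θ a h) (∫ o, ψ o ∂(P.emit h s)))
    (hθ : ∀ h < σ.H, ∀ a, ‖θ a h‖ ≤ σ.Θ)
    (hgap : ∀ h < σ.H, ∀ s a, 0 < P.gap p σ.H h s a → σ.Δ ≤ P.gap p σ.H h s a)
    (hargmax : ∀ (f : A → ℝ) (a : A), f a ≤ f (argmax f)) :
    ENNReal.ofReal (1 - σ.δ) ≤
      EQDP.successProb (σ.params ψ argmax) P fun l N =>
        P.IsOptimalSeq σ.H l ∧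
        (N : ℝ) ≤ 10 ^ 9 * Real.log σ.scale ^ 3 *
          (σ.H ^ 5 * (σ.Θ / σ.Δ) ^ 2 * σ.d ^ 2 * σ.A ^ 2 * Real.log (1 / σ.δ)) := by
  refine (σ.accurateModel hA hψ hψ1 hp hQ hθ hgap hargmax).le_successProb σ.one_le_inflation
    (hA ▸ σ.ofReal_mul_inflation_pow_le) fun l j hl hV hj =>
      ⟨EQDP.POMDP.isOptimalSeq_of_pathReward hp hl hV, le_trans ?_ σ.samples_le⟩
  have hestimates : j ≤ σ.estimates := by rwa [EQDP.Setting.estimates, ← hA]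
  exact_mod_cast Nat.mul_le_mul_left σ.H (Nat.mul_le_mul_right σ.episodes hestimates)

theorem mainTheorem1 :
    ∃ (C : ℝ) (m : ℕ), 0 < C ∧
    ∀ (A : Type*) [Fintype A] [Nonempty A] (H d : ℕ) (Θ Δ δ : ℝ),
      0 < H → 1 ≤ Θ → 0 < Δ → Δ ≤ Θ → 0 < δ → δ ≤ 1 / 2 →
    ∃ (lam : ℝ) (M : ℕ) (ε : ℝ), 0 < lam ∧ 0 < M ∧ 0 < ε ∧
    ∀ (S O : Type*) [MeasurableSpace S] [MeasurableSpace O] (P : EQDP.POMDP S A O)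
      (ds : ℕ) (ψ : O → EuclideanSpace ℝ (Fin d)) (φ : S → EuclideanSpace ℝ (Fin ds))
      (G : ℕ → Matrix (Fin d) (Fin ds) ℝ) (p : ℕ → S → A → S)
      (w : A → ℕ → EuclideanSpace ℝ (Fin ds)) (W : ℝ) (argmax : (A → ℝ) → A),
      0 < ds →
      -- the observation feature is measurable and bounded by one
      Measurable ψ → (∀ o, ‖ψ o‖ ≤ 1) →
      -- left-invertible linear conditional mean embedding
      (∀ h < H, ∃ Gd : Matrix (Fin ds) (Fin d) ℝ, Gd * G h = 1) →
      (∀ h < H, ∀ s, ∫ o, ψ o ∂(P.emit h s) = Matrix.toEuclideanLin (G h) (φ s)) →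
      -- deterministic latent transitions
      (∀ h < H, ∀ s a, P.trans h a s = MeasureTheory.Measure.dirac (p h s a)) →
      -- linear optimal Q-function
      (∀ h < H, ∀ s a, P.Qstar p H h s a = inner ℝ (w a h) (φ s)) →
      (∀ h < H, ∀ a, ‖w a h‖ ≤ W) →
      -- suboptimality gap
      (∀ h < H, ∀ s a, 0 < P.gap p H h s a → Δ ≤ P.gap p H h s a) →
      Θ = W / ⨅ h : Fin H, EQDP.smallestSingularValue (G h) →
      -- `argmax` selects a maximizer, ties being broken in any way
      (∀ (f : A → ℝ) (a : A), f a ≤ f (argmax f)) →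
      ENNReal.ofReal (1 - δ) ≤
        EQDP.successProb ⟨H, ψ, M, ε, lam, argmax⟩ P (fun l N =>
          P.IsOptimalSeq H l ∧
          (N : ℝ) ≤
            C * Real.log (2 + H + d + Fintype.card A + Θ + 1 / Δ + Real.log (1 / δ)) ^ m *
              ((H : ℝ) ^ 5 * Θ ^ 5 * (d : ℝ) ^ 2 * (Fintype.card A : ℝ) ^ 2 * (1 / Δ) ^ 5 *
                Real.log (1 / δ))) := by
  refine ⟨10 ^ 9, 3, by norm_num, fun A _ _ H d Θ Δ δ hH hΘ hΔ hΔΘ hδ hδ2 => ?_⟩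
  rcases Nat.eq_zero_or_pos d with rfl | hd
  · refine ⟨1, 1, 1, one_pos, one_pos, one_pos, ?_⟩
    intro S O _ _ P ds ψ φ G p w W argmax hds _ _ hG
    obtain ⟨Gd, hGd⟩ := hG 0 hH
    exact absurd (EQDP.le_of_leftInverse hGd) hds.not_ge
  let σ : EQDP.Setting :=
    ⟨Fintype.card A, H, d, Θ, Δ, δ, Fintype.card_pos, hH, hd, hΘ, hΔ, hΔΘ, hδ, hδ2⟩
  refine ⟨σ.lam, σ.episodes, 1, σ.lam_pos, σ.episodes_pos, one_pos, ?_⟩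
  intro S O _ _ P ds ψ φ G p w W argmax _ hψ hψ1 hG hemb hp hQ hw hgap hΘW hargmax
  have hη : (⨅ h : Fin H, EQDP.smallestSingularValue (G h)) ≠ 0 := fun h0 => by
    rw [h0, div_zero] at hΘW
    linarith
  choose! θ hθ hinner using fun (a : A) h (hh : h < H) =>
    EQDP.exists_inner_toEuclideanLin_eq hh hη (hG h hh) (hw h hh a)
  have hQψ : ∀ h < H, ∀ s a, P.Qstar p H h s a = inner ℝ (θ a h) (∫ o, ψ o ∂(P.emit h s)) :=
    fun h hh s a => by rw [hemb h hh, hinner a h hh, hQ h hh]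
  exact (mainTheorem1_general σ rfl hψ hψ1 hp hQψ (fun h hh a => (hθ a h hh).trans_eq hΘW.symm)
    hgap hargmax).trans
      (EQDP.successProb_mono fun l N hN => ⟨hN.1, hN.2.trans σ.ratio_sq_bound_le⟩)
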